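/- Around each point $u$ of the plane consider the six cones with apex $u$ bounded by the rays at consecutive multiples of $\pi/3$ from the positive $x$-axis. In counter-clockwise order starting at the positive $x$-axis, the first, third and fifth are called negative and the second, fourth and sixth positive. Let $P$ be a finite set of points in the plane such that no two of its points lie on a line parallel to a cone boundary. The half-$\theta_6$-graph of $P$ has vertex set $P$, and each $u\in P$ is joined by an edge, in each of its positive cones that contains another point of $P$, to the point of $P$ in this cone whose orthogonal projection onto the bisector of the cone is closest to $u$. Edges have their Euclidean length. A deterministic $k$-local $0$-memory routing algorithm chooses the vertex to which a message is forwarded as a function of the current vertex $s$, the destination $t$ (both given by their coordinates), and the set $N_k(s)$ of vertices reachable from $s$ by at most $k$ edges. It is $d$-competitive, for a class of pairs (source, destination), if on the half-$\theta_6$-graph of every such $P$ and for every pair of distinct vertices in the class, the message follows edges of the graph, reaches its destination, and travels a total distance of at most $d$ times the Euclidean distance between source and destination. Its routing ratio for this class is the smallest $d$ for which it is $d$-competitive. The spanning ratio of the half-$\theta_6$-graph is the smallest $r \ge 1$ such that for every such $P$ and all $u,v\in P$ the shortest path between $u$ and $v$ in the half-$\theta_6$-graph of $P$ has length at most $r\,|uv|$.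 Corollary. There is a deterministic $1$-local $0$-memory routing algorithm on the half-$\theta_6$-graph with routing ratio i) $2$ when the destination lies in a positive cone of the source, ii) $5/\sqrt3 = 2.886\ldots$ when the destination lies in a negative cone of the source, and hence with routing ratio $5/\sqrt3$ over all pairs. Both ratios are best possible: for every constant $k$, if a deterministic $k$-local $0$-memory routing algorithm is $d$-competitive for destinations in a positive cone of the source, then $d\ge 2$, and if it is $d$-competitive for destinations in a negative cone of the source, then $d\ge 5/\sqrt3$. In particular, the spanning ratio of the half-$\theta_6$-graph is $2 < 5/\sqrt3$, so every deterministic $k$-local $0$-memory routing algorithm that is $d$-competitive over all pairs has $d$ strictly larger than the spanning ratio. -/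

import Mathlib

noncomputable section

namespace HalfTheta

/-- The Euclidean plane. Vertices are identified with their coordinates. -/
abbrev Plane : Type := EuclideanSpace ℝ (Fin 2)

/-- The unit vector at angle `θ`, counter-clockwise from the positive `x`-axis. -/
def dir (θ : ℝ) : Plane := !₂[Real.cos θ, Real.sin θ]

/-- The (closed) cone with apex `u` between the rays at angles `m * π / 3` and
`(m + 1) * π / 3`. For `m = 0, …, 5` these are the six cones around `u`, in counter-clockwise
order starting from the positive `x`-axis. -/
def cone (u : Plane) (m : ℕ) : Set Plane :=
  {v | ∃ a b : ℝ, 0 ≤ a ∧ 0 ≤ b ∧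
    v = u + a • dir (m * (Real.pi / 3)) + b • dir ((m + 1) * (Real.pi / 3))}

/-- The direction of the bisector of `cone u m`. -/
def bisector (m : ℕ) : Plane := dir (m * (Real.pi / 3) + Real.pi / 6)

/-- The three positive cones of `u`: the second, fourth and sixth cone. -/
def positiveCone (u : Plane) (i : Fin 3) : Set Plane := cone u (2 * (i : ℕ) + 1)

/-- The three negative cones of `u`: the first, third and fifth cone. -/
def negativeCone (u : Plane) (i : Fin 3) : Set Plane := cone u (2 * (i : ℕ))

/-- `v` lies in a positive cone of `u`. -/
def InPositiveCone (u v : Plane) : Prop := ∃ i, v ∈ positiveCone u i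

/-- `v` lies in a negative cone of `u`. -/
def InNegativeCone (u v : Plane) : Prop := ∃ i, v ∈ negativeCone u i

/-- No two points of `P` lie on a line parallel to a cone boundary. -/
def GeneralPosition (P : Finset Plane) : Prop :=
  ∀ p ∈ P, ∀ q ∈ P, p ≠ q → ∀ (m : ℕ) (c : ℝ), q - p ≠ c • dir (m * (Real.pi / 3))

/-- `v` is the vertex of `P` in the `i`-th positive cone of `u` whose projection on the bisector
of that cone is closest to `u`. -/
def IsClosest (P : Finset Plane) (u : Plane) (i : Fin 3) (v : Plane) : Prop :=
  v ∈ P ∧ v ≠ u ∧ v ∈ positiveCone u i ∧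
    ∀ x ∈ P, x ≠ u → x ∈ positiveCone u i →
      inner ℝ (v - u) (bisector (2 * (i : ℕ) + 1)) ≤ inner ℝ (x - u) (bisector (2 * (i : ℕ) + 1))

/-- The half-`θ₆`-graph of `P`: every vertex has an edge to the closest vertex in each of its
positive cones. (As a graph on the whole plane, whose edges all join points of `P`.) -/
def halfThetaSix (P : Finset Plane) : SimpleGraph Plane where
  Adj u v := (u ∈ P ∧ ∃ i, IsClosest P u i v) ∨ (v ∈ P ∧ ∃ i, IsClosest P v i u)
  symm := ⟨fun _ _ h => h.symm⟩
  loopless := ⟨fun _ h => by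
    rcases h with ⟨_, _, _, h, _⟩ | ⟨_, _, _, h, _⟩ <;> exact h rfl⟩

/-- The set of vertices that can be reached from `s` by following at most `k` edges. -/
def kNeighborhood (P : Finset Plane) (k : ℕ) (s : Plane) : Set Plane :=
  {v | ∃ p : (halfThetaSix P).Walk s v, p.length ≤ k}

/-- A deterministic `0`-memory local forwarding rule: the vertex to which a message is forwarded
is a function of the current vertex, the destination and the neighborhood of the current
vertex. It is run as a `k`-local algorithm by feeding it `k`-neighborhoods. -/
abbrev RoutingAlgorithm : Type := Plane → Plane → Set Plane → Plane

/-- The position after `n` steps of a message sent from `s` to `t`, when `A` is run as a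
`k`-local algorithm on the half-`θ₆`-graph of `P`. -/
def position (k : ℕ) (A : RoutingAlgorithm) (P : Finset Plane) (s t : Plane) (n : ℕ) : Plane :=
  (fun x => A x t (kNeighborhood P k x))^[n] s

/-- The message sent from `s` to `t` only follows edges, reaches `t`, and has travelled a total
distance of at most `L` when it first does so. -/
def DeliversWithin (k : ℕ) (A : RoutingAlgorithm) (P : Finset Plane) (s t : Plane) (L : ℝ) :
    Prop :=
  ∃ n : ℕ, position k A P s t n = t ∧
    (∀ i < n, position k A P s t i ≠ t ∧
      (halfThetaSix P).Adj (position k A P s t i) (position k A P s t (i + 1))) ∧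
    ∑ i ∈ Finset.range n, dist (position k A P s t i) (position k A P s t (i + 1)) ≤ L

/-- `A`, run as a `k`-local algorithm on half-`θ₆`-graphs, is `d`-competitive for the
source-destination pairs in the relation `R`. -/
def IsCompetitive (k : ℕ) (A : RoutingAlgorithm) (R : Plane → Plane → Prop) (d : ℝ) : Prop :=
  ∀ P : Finset Plane, GeneralPosition P → ∀ s ∈ P, ∀ t ∈ P, s ≠ t → R s t →
    DeliversWithin k A P s t (d * dist s t)

/-- The routing ratio: the smallest `d` for which the algorithm is `d`-competitive. -/
def HasRoutingRatio (k : ℕ) (A : RoutingAlgorithm) (R : Plane → Plane → Prop) (d : ℝ) : Prop :=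
  IsLeast {d' : ℝ | IsCompetitive k A R d'} d

/-- The Euclidean length of a walk. -/
def walkLength {G : SimpleGraph Plane} {u v : Plane} (p : G.Walk u v) : ℝ :=
  (p.darts.map fun e => dist e.fst e.snd).sum

/-- The distance in a geometric graph: the length of a shortest path (`∞` if there is none). -/
def graphDist (G : SimpleGraph Plane) (u v : Plane) : ENNReal :=
  ⨅ p : G.Walk u v, ENNReal.ofReal (walkLength p)

/-- `r` is the spanning ratio of the half-`θ₆`-graph: the smallest `r ≥ 1` such that, for every
finite point set, the half-`θ₆`-graph is an `r`-spanner of the complete Euclidean graph. -/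
def IsSpanningRatio (r : ℝ) : Prop :=
  IsLeast {r' : ℝ | 1 ≤ r' ∧ ∀ P : Finset Plane, GeneralPosition P → ∀ u ∈ P, ∀ v ∈ P,
    graphDist (halfThetaSix P) u v ≤ ENNReal.ofReal (r' * dist u v)} r

end HalfTheta

end

noncomputable section

namespace HalfTheta

/-! Everything is expressed in three coordinates `tri 0`, `tri 1`, `tri 2` with sum zero. The `i`-th
positive cone of `u` is where the other two coordinates do not exceed those of `u`; its closest
vertex minimises `tri i`, and general position means that distinct points differ in every
coordinate. If two coordinates change by `a` and `b`, the squared distance is `a² + ab + b²`.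

Upper bounds: a potential bounds the remaining route (`Admissible`) and drops by at least the length
of each edge followed (`ForwardingRule.progress`). Let `a`, `b` be the absolute changes of the two
coordinates defining the cone, so the canonical triangle has side `a + b`. For a positive
destination the potential is `a + b + max a b`. For a negative one it is `2 (a + b) + min a b` in
general. Once one side region of the triangle is known to be empty, it is `a + b` plus the change
along the other side. Hugging the empty side keeps it empty, so this knowledge is recovered locally
and needs no memory. An edge that overshoots a positive destination also leaves an empty side
behind. Comparing with `√(a² + ab + b²)` gives `2` and `5 / √3`.

Lower bound `2`: from one corner of a nearly equilateral triangle, the only way to the second corner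
is through the third. This bounds the spanning ratio as well; reversing routes shows that ratio is
at most `2`.

Lower bound `5 / √3`: the source is the midpoint of the side opposite the destination, and a chain
of points alternates between the ends of this side. Only the last chain point sees the destination.
Its parity is invisible to the source, so an adversary chooses it after the first step. The message
then travels about `1/2 + 1 + 1`, against a distance of `√3 / 2`. -/

/-! ### Triangular coordinates and distances. -/

/-- The signed position of a point along the bisector of the `i`-th positive cone, scaled so that
the canonical triangle of two points has the difference of this coordinate as its side length. -/
def tri (i : Fin 3) (p : Plane) : ℝ :=
  ![2 / √3 * p 1, -p 0 - p 1 / √3, p 0 - p 1 / √3] i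

theorem tri_add (i : Fin 3) (p q : Plane) : tri i (p + q) = tri i p + tri i q := by
  fin_cases i <;> simp [tri] <;> ring

theorem tri_smul (i : Fin 3) (c : ℝ) (p : Plane) : tri i (c • p) = c * tri i p := by
  fin_cases i <;> simp [tri] <;> ring

theorem tri_sub (i : Fin 3) (p q : Plane) : tri i (p - q) = tri i p - tri i q := by
  fin_cases i <;> simp [tri] <;> ring

theorem tri_zero (i : Fin 3) : tri i 0 = 0 := by
  fin_cases i <;> simp [tri]

/-- The three indices are pairwise distinct. -/
def Distinct (i j k : Fin 3) : Prop := i ≠ j ∧ i ≠ k ∧ j ≠ k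

theorem Distinct.swap {i j k : Fin 3} (h : Distinct i j k) : Distinct i k j :=
  ⟨h.2.1, h.1, h.2.2.symm⟩

theorem Distinct.rotate {i j k : Fin 3} (h : Distinct i j k) : Distinct j k i :=
  ⟨h.2.2, h.1.symm, h.2.1.symm⟩

theorem Distinct.eq_or {i j k : Fin 3} (h : Distinct i j k) (l : Fin 3) :
    l = i ∨ l = j ∨ l = k := by
  revert i j k l; unfold Distinct; decide

theorem exists_distinct (i : Fin 3) : ∃ j k, Distinct i j k := by
  revert i; unfold Distinct; decide

theorem tri_sum {i j k : Fin 3} (h : Distinct i j k) (p : Plane) :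
    tri i p + tri j p + tri k p = 0 := by
  obtain ⟨h1, h2, h3⟩ := h
  fin_cases i <;> fin_cases j <;> fin_cases k <;> simp at h1 h2 h3 <;> simp [tri] <;> ring

theorem norm_sq_eq_tri (p : Plane) :
    ‖p‖ ^ 2 = (tri 0 p ^ 2 + tri 1 p ^ 2 + tri 2 p ^ 2) / 2 := by
  have h3 : √3 ≠ 0 := by positivity
  have h3' : √3 ^ 2 = 3 := Real.sq_sqrt (by norm_num)
  rw [EuclideanSpace.norm_sq_eq, Fin.sum_univ_two]
  simp only [tri, Real.norm_eq_abs, sq_abs, Matrix.cons_val]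
  field_simp
  rw [h3']
  linear_combination (-2 * p 0 ^ 2) * h3'

theorem dist_sq_eq {i j k : Fin 3} (h : Distinct i j k) (p q : Plane) :
    dist p q ^ 2 = (tri j q - tri j p) ^ 2 + (tri j q - tri j p) * (tri k q - tri k p)
      + (tri k q - tri k p) ^ 2 := by
  have key : ∀ v : Plane, ‖v‖ ^ 2 = tri j v ^ 2 + tri j v * tri k v + tri k v ^ 2 := by
    intro v
    rw [norm_sq_eq_tri]
    have hs := tri_sum (i := 0) (j := 1) (k := 2) ⟨by decide, by decide, by decide⟩ v
    have e : tri 0 v = - tri 1 v - tri 2 v := by linarith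
    obtain ⟨h1, h2, h3⟩ := h
    fin_cases i <;> fin_cases j <;> fin_cases k <;> simp at h1 h2 h3 <;> simp only [
      Fin.mk_zero, Fin.mk_one, Fin.reduceFinMk] <;> rw [e] <;> ring
  rw [dist_comm, dist_eq_norm, key, tri_sub, tri_sub]

theorem ext_tri {i j k : Fin 3} (h : Distinct i j k) {p q : Plane} (hj : tri j p = tri j q)
    (hk : tri k p = tri k q) : p = q := by
  have := dist_sq_eq h p q
  rw [hj, hk] at this
  simpa using this

/-- For `a, b ≥ 0` one has `a² + ab + b² ≤ (a + b)²`. Every upper bound on the length of an edge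
comes from here. -/
theorem dist_le_of_le {i j k : Fin 3} (h : Distinct i j k) {u v : Plane}
    (hj : tri j v ≤ tri j u) (hk : tri k v ≤ tri k u) : dist u v ≤ tri i v - tri i u := by
  have h1 := tri_sum h u
  have h2 := tri_sum h v
  refine le_of_sq_le_sq ?_ (by linarith)
  rw [dist_sq_eq h]
  have e : tri i v - tri i u = (tri j u - tri j v) + (tri k u - tri k v) := by linarith
  rw [e]
  nlinarith [mul_nonneg (sub_nonneg.2 hj) (sub_nonneg.2 hk)]

/-- Follows from `a² + ab + b² = ((a - b) / 2)² + 3 ((a + b) / 2)²`. The lower-bound constructions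
estimate their lengths with it. -/
theorem half_sub_le_dist {i j k : Fin 3} (h : Distinct i j k) (u v : Plane) :
    ((tri j v - tri j u) - (tri k v - tri k u)) / 2 ≤ dist u v := by
  refine le_of_sq_le_sq ?_ dist_nonneg
  rw [dist_sq_eq h]
  nlinarith [sq_nonneg ((tri j v - tri j u) + (tri k v - tri k u))]

/-- The point with given last two triangular coordinates. -/
def ofTri (x y : ℝ) : Plane := !₂[(y - x) / 2, -(√3 / 2) * (x + y)]

theorem tri_zero_ofTri (x y : ℝ) : tri 0 (ofTri x y) = -x - y := by
  have h3 : √3 ≠ 0 := by positivity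
  simp only [tri, ofTri, PiLp.toLp_apply, Matrix.cons_val]
  field_simp
  ring

theorem tri_one_ofTri (x y : ℝ) : tri 1 (ofTri x y) = x := by
  have h3 : √3 ≠ 0 := by positivity
  simp only [tri, ofTri, PiLp.toLp_apply, Matrix.cons_val]
  field_simp
  ring

theorem tri_two_ofTri (x y : ℝ) : tri 2 (ofTri x y) = y := by
  have h3 : √3 ≠ 0 := by positivity
  simp only [tri, ofTri, PiLp.toLp_apply, Matrix.cons_val]
  field_simp
  ring

theorem distinct_zero_one_two : Distinct 0 1 2 := ⟨by decide, by decide, by decide⟩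

theorem dir_zero : dir 0 = ofTri (-1) 1 := by
  ext i; fin_cases i <;> simp [dir, ofTri]

theorem dir_one : dir (Real.pi / 3) = ofTri (-1) 0 := by
  ext i; fin_cases i <;> simp [dir, ofTri]

theorem dir_two : dir (2 * (Real.pi / 3)) = ofTri 0 (-1) := by
  have e : 2 * (Real.pi / 3) = Real.pi - Real.pi / 3 := by ring
  rw [e]
  ext i; fin_cases i <;> simp [dir, ofTri]; norm_num

theorem dir_add_pi (θ : ℝ) : dir (θ + Real.pi) = (-1 : ℝ) • dir θ := by
  ext i; fin_cases i <;> simp [dir]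

theorem neg_one_smul_ofTri (x y : ℝ) : (-1 : ℝ) • ofTri x y = ofTri (-x) (-y) := by
  ext i; fin_cases i <;> simp [ofTri] <;> ring

theorem dir_three : dir (3 * (Real.pi / 3)) = ofTri 1 (-1) := by
  have e : 3 * (Real.pi / 3) = 0 + Real.pi := by ring
  rw [e, dir_add_pi, dir_zero, neg_one_smul_ofTri]; simp

theorem dir_four : dir (4 * (Real.pi / 3)) = ofTri 1 0 := by
  have e : 4 * (Real.pi / 3) = Real.pi / 3 + Real.pi := by ring
  rw [e, dir_add_pi, dir_one, neg_one_smul_ofTri]; simp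

theorem dir_five : dir (5 * (Real.pi / 3)) = ofTri 0 1 := by
  have e : 5 * (Real.pi / 3) = 2 * (Real.pi / 3) + Real.pi := by ring
  rw [e, dir_add_pi, dir_two, neg_one_smul_ofTri]; simp

theorem dir_six : dir (6 * (Real.pi / 3)) = ofTri (-1) 1 := by
  have e : 6 * (Real.pi / 3) = 3 * (Real.pi / 3) + Real.pi := by ring
  rw [e, dir_add_pi, dir_three, neg_one_smul_ofTri]; simp

theorem eq_add_ofTri_iff (u v : Plane) (a b x y x' y' : ℝ) :
    v = u + a • ofTri x y + b • ofTri x' y' ↔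
      tri 1 v - tri 1 u = a * x + b * x' ∧ tri 2 v - tri 2 u = a * y + b * y' := by
  constructor
  · rintro rfl
    simp only [tri_add, tri_smul, tri_one_ofTri, tri_two_ofTri]
    constructor <;> ring
  · rintro ⟨h1, h2⟩
    apply ext_tri distinct_zero_one_two <;>
    simp only [tri_add, tri_smul, tri_one_ofTri, tri_two_ofTri] <;> linarith

/-! ### Cones, general position and edges in triangular coordinates. -/

theorem mem_positiveCone_iff {i j k : Fin 3} (h : Distinct i j k) {u v : Plane} :
    v ∈ positiveCone u i ↔ tri j v ≤ tri j u ∧ tri k v ≤ tri k u := by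
  have hu := tri_sum distinct_zero_one_two u
  have hv := tri_sum distinct_zero_one_two v
  have key : v ∈ positiveCone u i ↔ ∀ l, l ≠ i → tri l v ≤ tri l u := by
    fin_cases i
    · simp only [positiveCone, cone, Set.mem_ofPred_eq, Fin.zero_eta, mul_zero,
        zero_add, Nat.cast_one, one_mul, one_add_one_eq_two, dir_one, dir_two, eq_add_ofTri_iff]
      constructor
      · rintro ⟨a, b, ha, hb, h1, h2⟩ l hl
        fin_cases l
        · simp at hl
        all_goals simp; linarith
      · intro H
        have H1 := H 1 (by decide)
        have H2 := H 2 (by decide)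
        exact ⟨tri 1 u - tri 1 v, tri 2 u - tri 2 v, by linarith, by linarith, by ring, by ring⟩
    · have e1 : (((2 * 1 + 1 : ℕ) : ℝ)) = 3 := by norm_num
      have e2 : (3 : ℝ) + 1 = 4 := by norm_num
      simp only [positiveCone, cone, Set.mem_ofPred_eq, Fin.mk_one, e1, e2, dir_three,
        dir_four, eq_add_ofTri_iff]
      constructor
      · rintro ⟨a, b, ha, hb, h1, h2⟩ l hl
        fin_cases l
        · simp; linarith
        · simp at hl
        · simp; linarith
      · intro H
        have H1 := H 0 (by decide)
        have H2 := H 2 (by decide)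
        exact ⟨tri 2 u - tri 2 v, tri 0 u - tri 0 v, by linarith, by linarith, by linarith,
          by linarith⟩
    · have e1 : (((2 * 2 + 1 : ℕ) : ℝ)) = 5 := by norm_num
      have e2 : (5 : ℝ) + 1 = 6 := by norm_num
      simp only [positiveCone, cone, Set.mem_ofPred_eq, Fin.reduceFinMk, e1, e2,
        dir_five, dir_six, eq_add_ofTri_iff]
      constructor
      · rintro ⟨a, b, ha, hb, h1, h2⟩ l hl
        fin_cases l
        · simp; linarith
        · simp; linarith
        · simp at hl
      · intro H
        have H1 := H 0 (by decide)
        have H2 := H 1 (by decide)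
        exact ⟨tri 0 u - tri 0 v, tri 1 u - tri 1 v, by linarith, by linarith, by linarith,
          by linarith⟩
  rw [key]
  constructor
  · intro H
    exact ⟨H j h.1.symm, H k h.2.1.symm⟩
  · rintro ⟨H1, H2⟩ l hl
    rcases h.eq_or l with rfl | rfl | rfl
    · exact absurd rfl hl
    · exact H1
    · exact H2

theorem cone_add_three (u v : Plane) (m : ℕ) : v ∈ cone u (m + 3) ↔ u ∈ cone v m := by
  have e1 : ((m + 3 : ℕ) : ℝ) * (Real.pi / 3) = m * (Real.pi / 3) + Real.pi := by
    push_cast; ring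
  have e2 : (((m + 3 : ℕ) : ℝ) + 1) * (Real.pi / 3) = (m + 1) * (Real.pi / 3) + Real.pi := by
    push_cast; ring
  simp only [cone, Set.mem_ofPred_eq, e1, e2, dir_add_pi]
  constructor
  · rintro ⟨a, b, ha, hb, rfl⟩
    exact ⟨a, b, ha, hb, by module⟩
  · rintro ⟨a, b, ha, hb, rfl⟩
    exact ⟨a, b, ha, hb, by module⟩

theorem cone_add_six (u : Plane) (m : ℕ) : cone u (m + 6) = cone u m := by
  ext v
  rw [show m + 6 = m + 3 + 3 from rfl, cone_add_three, cone_add_three]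

theorem inNegativeCone_iff (u v : Plane) : InNegativeCone u v ↔ InPositiveCone v u := by
  constructor
  · rintro ⟨i, hi⟩
    fin_cases i
    · refine ⟨1, ?_⟩
      have : v ∈ cone u (0 + 6) := by rw [cone_add_six]; exact hi
      exact (cone_add_three u v 3).1 this
    · refine ⟨2, ?_⟩
      have : v ∈ cone u (2 + 6) := by rw [cone_add_six]; exact hi
      exact (cone_add_three u v 5).1 this
    · exact ⟨0, (cone_add_three u v 1).1 hi⟩
  · rintro ⟨i, hi⟩
    fin_cases i
    · exact ⟨2, (cone_add_three u v 1).2 hi⟩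
    · exact ⟨0, by
        have := (cone_add_three u v 3).2 hi
        rwa [show 3 + 3 = 0 + 6 from rfl, cone_add_six] at this⟩
    · exact ⟨1, by
        have := (cone_add_three u v 5).2 hi
        rwa [show 5 + 3 = 2 + 6 from rfl, cone_add_six] at this⟩

theorem inner_bisector (i : Fin 3) (p : Plane) :
    inner ℝ p (bisector (2 * (i : ℕ) + 1)) = √3 / 2 * tri i p := by
  have h3 : √3 ≠ 0 := by positivity
  fin_cases i
  · have e : (((2 * 0 + 1 : ℕ) : ℝ)) * (Real.pi / 3) + Real.pi / 6 = Real.pi / 2 := by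
      push_cast; ring
    simp only [bisector, Fin.zero_eta, e]
    simp [dir, tri, PiLp.inner_apply]
    field_simp
  · have e : (((2 * 1 + 1 : ℕ) : ℝ)) * (Real.pi / 3) + Real.pi / 6 = Real.pi / 6 + Real.pi := by
      push_cast; ring
    simp only [bisector, Fin.mk_one, e]
    simp [dir, tri, PiLp.inner_apply]
    field_simp
    ring
  · have e : (((2 * 2 + 1 : ℕ) : ℝ)) * (Real.pi / 3) + Real.pi / 6
        = 2 * Real.pi - Real.pi / 6 := by
      push_cast; ring
    simp only [bisector, Fin.reduceFinMk, e]
    simp [dir, tri, PiLp.inner_apply]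
    field_simp
    ring

theorem isClosest_iff {P : Finset Plane} {i j k : Fin 3} (h : Distinct i j k) {u v : Plane} :
    IsClosest P u i v ↔ v ∈ P ∧ v ≠ u ∧ (tri j v ≤ tri j u ∧ tri k v ≤ tri k u) ∧
      ∀ x ∈ P, x ≠ u → tri j x ≤ tri j u → tri k x ≤ tri k u → tri i v ≤ tri i x := by
  have h3 : 0 < √3 / 2 := by positivity
  simp only [IsClosest, mem_positiveCone_iff h, inner_bisector, tri_sub, mul_le_mul_iff_right₀ h3,
    sub_le_sub_iff_right, and_imp]

theorem exists_tri_dir_eq_zero (m : ℕ) : ∃ i, tri i (dir (m * (Real.pi / 3))) = 0 := by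
  induction m using Nat.strong_induction_on with
  | _ m ih =>
    match m, ih with
    | 0, _ => exact ⟨0, by simp [dir_zero, tri_zero_ofTri]⟩
    | 1, _ => exact ⟨2, by simp [dir_one, tri_two_ofTri]⟩
    | 2, _ => exact ⟨1, by simp [dir_two, tri_one_ofTri]⟩
    -- Adding three to the index only reverses the direction, so the three base cases cover all
    -- boundaries.
    | m + 3, ih =>
      obtain ⟨i, hi⟩ := ih m (by omega)
      refine ⟨i, ?_⟩
      have e1 : ((m + 3 : ℕ) : ℝ) * (Real.pi / 3) = m * (Real.pi / 3) + Real.pi := by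
        push_cast; ring
      rw [e1, dir_add_pi, tri_smul, hi, mul_zero]

theorem generalPosition_iff (P : Finset Plane) :
    GeneralPosition P ↔ ∀ p ∈ P, ∀ q ∈ P, p ≠ q → ∀ i, tri i p ≠ tri i q := by
  constructor
  · intro H p hp q hq hne i he
    have hs := tri_sum distinct_zero_one_two (q - p)
    have he' : tri i (q - p) = 0 := by rw [tri_sub, he, sub_self]
    fin_cases i
    · apply H p hp q hq hne 0 (tri 2 (q - p))
      simp only [Nat.cast_zero, zero_mul, dir_zero]
      apply ext_tri distinct_zero_one_two <;>
        simp only [tri_smul, tri_one_ofTri, tri_two_ofTri] <;> simp at he' <;> linarith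
    · apply H p hp q hq hne 2 (- tri 2 (q - p))
      simp only [Nat.cast_ofNat, dir_two]
      apply ext_tri distinct_zero_one_two <;>
        simp only [tri_smul, tri_one_ofTri, tri_two_ofTri] <;> simp at he' <;> linarith
    · apply H p hp q hq hne 1 (- tri 1 (q - p))
      simp only [Nat.cast_one, one_mul, dir_one]
      apply ext_tri distinct_zero_one_two <;>
        simp only [tri_smul, tri_one_ofTri, tri_two_ofTri] <;> simp at he' <;> linarith
  · intro H p hp q hq hne m c he
    obtain ⟨i, hi⟩ := exists_tri_dir_eq_zero m
    apply H p hp q hq hne i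
    have := congrArg (tri i) he
    rw [tri_smul, hi, tri_sub] at this
    linarith

theorem GeneralPosition.tri_ne {P : Finset Plane} (hP : GeneralPosition P) {p q : Plane}
    (hp : p ∈ P) (hq : q ∈ P) (hne : p ≠ q) (i : Fin 3) : tri i p ≠ tri i q :=
  (generalPosition_iff P).1 hP p hp q hq hne i

theorem mem_of_adj {P : Finset Plane} {u v : Plane} (h : (halfThetaSix P).Adj u v) :
    u ∈ P ∧ v ∈ P := by
  rcases h with ⟨h, _, h', _⟩ | ⟨h, _, h', _⟩
  · exact ⟨h, h'⟩
  · exact ⟨h', h⟩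

/-- The edge must have been created by `u` in its `i`-th cone: `u` lies in no positive cone of `v`,
and `v` in no other positive cone of `u`. Hence `v` is the closest vertex there. -/
theorem tri_le_of_adj {P : Finset Plane} {i j k : Fin 3} (h : Distinct i j k) {u v x : Plane}
    (hadj : (halfThetaSix P).Adj u v) (hj : tri j v < tri j u) (hk : tri k v < tri k u)
    (hx : x ∈ P) (hxj : tri j x < tri j u) (hxk : tri k x < tri k u) : tri i v ≤ tri i x := by
  have hu := tri_sum h u
  have hv := tri_sum h v
  rcases hadj with ⟨-, l, hl⟩ | ⟨-, l, hl⟩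
  · rcases h.eq_or l with rfl | rfl | rfl
    · exact ((isClosest_iff h).1 hl).2.2.2 x hx (by rintro rfl; exact lt_irrefl _ hxj) hxj.le hxk.le
    · have := ((isClosest_iff h.rotate).1 hl).2.2.1.2
      linarith
    · have := ((isClosest_iff h.rotate.rotate).1 hl).2.2.1.1
      linarith
  · rcases h.eq_or l with rfl | rfl | rfl
    · have := ((isClosest_iff h).1 hl).2.2.1.1
      linarith
    · have := ((isClosest_iff h.rotate).1 hl).2.2.1.1
      linarith
    · have := ((isClosest_iff h.rotate.rotate).1 hl).2.2.1.2
      linarith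

theorem adj_of_forall_tri_le {P : Finset Plane} (hP : GeneralPosition P) {i j k : Fin 3}
    (h : Distinct i j k) {u v : Plane} (hu : u ∈ P) (hv : v ∈ P) (hj : tri j v < tri j u)
    (hk : tri k v < tri k u)
    (H : ∀ x ∈ P, tri j x < tri j u → tri k x < tri k u → tri i v ≤ tri i x) :
    (halfThetaSix P).Adj u v := by
  refine Or.inl ⟨hu, i, (isClosest_iff h).2 ⟨hv, ?_, ⟨hj.le, hk.le⟩, ?_⟩⟩
  · rintro rfl
    exact lt_irrefl _ hj
  · intro x hx hxu hxj hxk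
    exact H x hx (lt_of_le_of_ne hxj (hP.tri_ne hx hu hxu j))
      (lt_of_le_of_ne hxk (hP.tri_ne hx hu hxu k))

theorem exists_adj_of_mem_cone {P : Finset Plane} (hP : GeneralPosition P) {i j k : Fin 3}
    (h : Distinct i j k) {u x : Plane} (hu : u ∈ P) (hx : x ∈ P) (hj : tri j x < tri j u)
    (hk : tri k x < tri k u) :
    ∃ v, (halfThetaSix P).Adj u v ∧ tri j v < tri j u ∧ tri k v < tri k u := by
  classical
  obtain ⟨v, hv, hmin⟩ := Finset.exists_min_image
    (P.filter fun y => tri j y < tri j u ∧ tri k y < tri k u) (tri i)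
    ⟨x, Finset.mem_filter.2 ⟨hx, hj, hk⟩⟩
  rw [Finset.mem_filter] at hv
  refine ⟨v, adj_of_forall_tri_le hP h hu hv.1 hv.2.1 hv.2.2 ?_, hv.2⟩
  intro y hy hyj hyk
  exact hmin y (Finset.mem_filter.2 ⟨hy, hyj, hyk⟩)

/-! ### The forwarding rule. -/

/-- `x` lies in the `k`-th positive cone of `s` and in the canonical triangle of `t` and `s`, where
`s` lies in the `i`-th positive cone of `t`. -/
def InSide (s t : Plane) (i j k : Fin 3) (x : Plane) : Prop :=
  tri i x < tri i s ∧ tri j x < tri j s ∧ tri k x ≤ tri k t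

/-- `x` lies in the `i`-th negative cone of `s` and in the canonical triangle of `t` and `s`, where
`s` lies in the `i`-th positive cone of `t` and `j`, `k` are the other two indices. -/
def InMiddle (s t : Plane) (j k : Fin 3) (x : Plane) : Prop :=
  (tri j s < tri j x ∧ tri j x ≤ tri j t) ∧ (tri k s < tri k x ∧ tri k x ≤ tri k t)

/-- The forwarding rule for a destination in a positive cone: follow the edge in this cone. -/
def PositiveRule (s t : Plane) (w : Plane) : Prop :=
  ∃ i j k, Distinct i j k ∧ tri j t < tri j s ∧ tri k t < tri k s ∧
    tri j w < tri j s ∧ tri k w < tri k s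

/-- The forwarding rule for a destination in a negative cone when both sides of the canonical
triangle contain a neighbor: go to the neighbor on the smaller side. -/
def BothSidesRule (s t : Plane) (N : Set Plane) (i j k : Fin 3) (w : Plane) : Prop :=
  (∃ x ∈ N, InSide s t i j k x) ∧ (∃ x ∈ N, InSide s t i k j x) ∧
    tri j t - tri j s ≤ tri k t - tri k s ∧ InSide s t i k j w

/-- The forwarding rule for a destination in a negative cone when the `k`-th side of the canonical
triangle contains no neighbor: go to the neighbor in the middle that is closest to this side; if
there is none, go to the neighbor on the other side. If both sides contain no neighbor, the rule
may only be applied with `k` as the larger side. -/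
def EmptySideRule (s t : Plane) (N : Set Plane) (i j k : Fin 3) (w : Plane) : Prop :=
  (∀ x ∈ N, ¬ InSide s t i j k x) ∧
    ((∃ x ∈ N, InSide s t i k j x) ∨ tri j t - tri j s ≤ tri k t - tri k s) ∧
    ((InMiddle s t j k w ∧ ∀ x ∈ N, InMiddle s t j k x → tri j w ≤ tri j x) ∨
      ((∀ x ∈ N, ¬ InMiddle s t j k x) ∧ InSide s t i k j w))

/-- The forwarding rule of the routing algorithm. -/
def ForwardingRule (s t : Plane) (N : Set Plane) (w : Plane) : Prop :=
  w ∈ N ∧ (PositiveRule s t w ∨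
    ∃ i j k, Distinct i j k ∧ tri j s < tri j t ∧ tri k s < tri k t ∧
      (BothSidesRule s t N i j k w ∨ EmptySideRule s t N i j k w))

open Classical in
/-- The routing algorithm that forwards along the rule above. -/
def router : RoutingAlgorithm := fun s t N =>
  -- The value `s` is a filler: between distinct vertices in general position, fed with
  -- 1-neighborhoods, the rule always applies (`exists_forwardingRule`).
  if h : ∃ w, ForwardingRule s t N w then h.choose else s

theorem mem_kNeighborhood_one {P : Finset Plane} {s x : Plane} :
    x ∈ kNeighborhood P 1 s ↔ x = s ∨ (halfThetaSix P).Adj s x := by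
  constructor
  · rintro ⟨p, hp⟩
    cases p with
    | nil => exact Or.inl rfl
    | cons h q =>
      cases q with
      | nil => exact Or.inr h
      | cons h' q' => simp at hp
  · rintro (rfl | h)
    · exact ⟨.nil, by simp⟩
    · exact ⟨h.toWalk, by simp⟩

/-! ### Reading off neighbors and empty sides locally. -/

/-- A point of `P` in the middle such that all points of `P` seen from there below `u` stay in a
given part of the middle yields a neighbor of `u` in this part. -/
theorem exists_adj_middle {P : Finset Plane} (hP : GeneralPosition P) {i j k : Fin 3}
    (h : Distinct i j k) {u t : Plane} (hu : u ∈ P) (Q : Plane → Prop)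
    (hex : ∃ y ∈ P, InMiddle u t j k y ∧ Q y)
    (hQ : ∀ y ∈ P, InMiddle u t j k y → Q y → ∀ z ∈ P, tri j z < tri j y → tri k z < tri k y →
      tri i z < tri i u → InMiddle u t j k z ∧ Q z) :
    ∃ y, (halfThetaSix P).Adj u y ∧ InMiddle u t j k y ∧ Q y := by
  classical
  obtain ⟨y₀, hy₀, hm₀, hq₀⟩ := hex
  obtain ⟨y, hy, hmax⟩ := Finset.exists_max_image
    (P.filter fun y => InMiddle u t j k y ∧ Q y) (tri i)
    ⟨y₀, Finset.mem_filter.2 ⟨hy₀, hm₀, hq₀⟩⟩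
  rw [Finset.mem_filter] at hy
  obtain ⟨hyP, hm, hq⟩ := hy
  -- The edge is created by `y`: a point of its cone met before `u` would lie in the same region
  -- with a larger `tri i`, against the choice of `y`.
  refine ⟨y, (adj_of_forall_tri_le hP h hyP hu hm.1.1 hm.2.1 ?_).symm, hm, hq⟩
  intro z hz hzj hzk
  by_contra! hlt
  have := hmax z (Finset.mem_filter.2 ⟨hz, hQ y hyP hm hq z hz hzj hzk hlt⟩)
  have h1 := tri_sum h y
  have h2 := tri_sum h z
  linarith

/-- The closest vertex in the `k`-th cone has the least `tri k`, so an occupied side contains a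
neighbor. Emptiness of a side is thus visible from the 1-neighborhood. -/
theorem forall_not_inSide {P : Finset Plane} (hP : GeneralPosition P) {i j k : Fin 3}
    (h : Distinct i j k) {u t : Plane} (hu : u ∈ P)
    (H : ∀ x ∈ kNeighborhood P 1 u, ¬ InSide u t i j k x) : ∀ x ∈ P, ¬ InSide u t i j k x := by
  rintro x hx ⟨h1, h2, h3⟩
  obtain ⟨v, hv, hv1, hv2⟩ := exists_adj_of_mem_cone hP h.rotate.rotate hu hx h1 h2
  refine H v (mem_kNeighborhood_one.2 (Or.inr hv)) ⟨hv1, hv2, ?_⟩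
  exact (tri_le_of_adj h.rotate.rotate hv hv1 hv2 hx h1 h2).trans h3

/-- If the `k`-th side is empty and `β` bounds the `j`-th coordinates on the `j`-th side from below,
then a point of the triangle below `u` with smaller `j`-th coordinate yields such a neighbor in the
middle. -/
theorem exists_adj_middle_lt {P : Finset Plane} (hP : GeneralPosition P) {i j k : Fin 3}
    (h : Distinct i j k) {u t : Plane} (hu : u ∈ P)
    (hside : ∀ x ∈ P, ¬ InSide u t i j k x) {β : ℝ} (hβt : β ≤ tri j t)
    (hβ : ∀ z ∈ P, tri i z < tri i u → tri k z < tri k u → β ≤ tri j z)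
    {y : Plane} (hy : y ∈ P) (hyi : tri i y < tri i u) (hyj : tri j y < β)
    (hyk : tri k y ≤ tri k t) :
    ∃ y, (halfThetaSix P).Adj u y ∧ InMiddle u t j k y ∧ tri j y < β := by
  -- Such a point is kept off the `k`-th side by `hside` and off the `j`-th side by `hβ`; only the
  -- middle remains.
  have key : ∀ z ∈ P, tri i z < tri i u → tri j z < β → tri k z ≤ tri k t →
      InMiddle u t j k z := by
    intro z hz hzi hzj hzk
    have hne : z ≠ u := by rintro rfl; exact lt_irrefl _ hzi
    refine ⟨⟨?_, by linarith⟩, ?_, hzk⟩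
    · refine lt_of_le_of_ne (not_lt.1 fun hlt => hside z hz ⟨hzi, hlt, hzk⟩)
        (hP.tri_ne hz hu hne j).symm
    · refine lt_of_le_of_ne (not_lt.1 fun hlt => ?_) (hP.tri_ne hz hu hne k).symm
      have := hβ z hz hzi hlt
      linarith
  refine exists_adj_middle hP h hu (fun y => tri j y < β) ⟨y, hy, key y hy hyi hyj hyk, hyj⟩ ?_
  intro y hy hm hyβ z hz hzj hzk hzi
  exact ⟨key z hz hzi (by linarith) (hzk.le.trans hm.2.2), by linarith⟩

/-! ### The potential and its decrease along edges. -/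

/-- `φ` is an admissible value of the potential at `u`: a bound on the length of the route from `u`
to `t`. -/
def Admissible (P : Finset Plane) (t u : Plane) (φ : ℝ) : Prop :=
  ∃ i j k, Distinct i j k ∧
    ((tri j t < tri j u ∧ tri k t < tri k u ∧ tri i t - tri i u + (tri j u - tri j t) ≤ φ ∧
        tri i t - tri i u + (tri k u - tri k t) ≤ φ) ∨
      (tri j u < tri j t ∧ tri k u < tri k t ∧
        ((∀ x ∈ P, ¬ InSide u t i j k x) ∧ tri i u - tri i t + (tri j t - tri j u) ≤ φ ∨
          2 * (tri i u - tri i t) + (tri j t - tri j u) ≤ φ)))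

theorem Admissible.nonneg {P : Finset Plane} {t u : Plane} {φ : ℝ} (H : Admissible P t u φ) :
    0 ≤ φ := by
  obtain ⟨i, j, k, h, H⟩ := H
  have h1 := tri_sum h t
  have h2 := tri_sum h u
  rcases H with ⟨H1, H2, H3, -⟩ | ⟨H1, H2, ⟨-, H3⟩ | H3⟩ <;> linarith

theorem Admissible.ne {P : Finset Plane} {t u : Plane} {φ : ℝ} (H : Admissible P t u φ) :
    u ≠ t := by
  obtain ⟨i, j, k, h, H⟩ := H
  rintro rfl
  rcases H with ⟨H1, -⟩ | ⟨H1, -⟩ <;> exact lt_irrefl _ H1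

/-- After overshooting, `t` is in a negative cone of `w`. A point in the `j`-th side seen from `w`
would lie in the `i`-th cone of `u` and come before `w`. That side is therefore empty, and the
cheaper form of the potential is available. -/
theorem admissible_of_overshoot {P : Finset Plane} {i j k : Fin 3}
    (h : Distinct i j k) {t u w : Plane} {φ : ℝ} (htj : tri j t < tri j u)
    (hφ : tri i t - tri i u + (tri k u - tri k t) ≤ φ)
    (hw : (halfThetaSix P).Adj u w) (hwj : tri j w < tri j u) (hwk : tri k w < tri k u)
    (hlt : tri j w < tri j t) (hwi : tri i w < tri i t) :
    Admissible P t w (φ - dist u w) := by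
  have hd := dist_le_of_le h hwj.le hwk.le
  refine ⟨k, i, j, h.rotate.rotate, Or.inr ⟨hwi, hlt, Or.inl ⟨?_, by linarith⟩⟩⟩
  rintro x hx ⟨hx1, hx2, hx3⟩
  have := tri_le_of_adj h hw hwj hwk hx (by linarith) (by linarith)
  linarith

theorem positiveRule_progress {P : Finset Plane} (hP : GeneralPosition P) {i j k : Fin 3}
    (h : Distinct i j k) {t u w : Plane} {φ : ℝ} (ht : t ∈ P)
    (htj : tri j t < tri j u) (htk : tri k t < tri k u)
    (hφj : tri i t - tri i u + (tri j u - tri j t) ≤ φ)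
    (hφk : tri i t - tri i u + (tri k u - tri k t) ≤ φ)
    (hw : (halfThetaSix P).Adj u w) (hwj : tri j w < tri j u) (hwk : tri k w < tri k u) :
    dist u w ≤ φ ∧ (w = t ∨ Admissible P t w (φ - dist u w)) := by
  have hd := dist_le_of_le h hwj.le hwk.le
  have hle := tri_le_of_adj h hw hwj hwk ht htj htk
  refine ⟨by linarith, or_iff_not_imp_left.2 fun hne => ?_⟩
  have hwP := (mem_of_adj hw).2
  have hi := lt_of_le_of_ne hle (hP.tri_ne hwP ht hne i)
  rcases lt_or_gt_of_ne (hP.tri_ne hwP ht hne j) with hj | hj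
  · exact admissible_of_overshoot h htj hφk hw hwj hwk hj hi
  rcases lt_or_gt_of_ne (hP.tri_ne hwP ht hne k) with hk | hk
  · exact admissible_of_overshoot h.swap htk hφj hw hwk hwj hk hi
  exact ⟨i, j, k, h, Or.inl ⟨hj, hk, by linarith, by linarith⟩⟩

/-- The edge costs at most the drop of `tri i` plus the gain of `tri j`, exactly what the potential
loses. The substance is that the `k`-th side is empty again as seen from `w`. -/
theorem emptySide_progress {P : Finset Plane} (hP : GeneralPosition P) {i j k : Fin 3}
    (h : Distinct i j k) {t u w : Plane} {φ : ℝ} (hu : u ∈ P) (ht : t ∈ P)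
    (htk : tri k u < tri k t)
    (hside : ∀ x ∈ P, ¬ InSide u t i j k x)
    (hφ : tri i u - tri i t + (tri j t - tri j u) ≤ φ)
    (hw : (halfThetaSix P).Adj u w)
    (hrule : (InMiddle u t j k w ∧
        ∀ x ∈ kNeighborhood P 1 u, InMiddle u t j k x → tri j w ≤ tri j x) ∨
      ((∀ x ∈ kNeighborhood P 1 u, ¬ InMiddle u t j k x) ∧ InSide u t i k j w)) :
    dist u w ≤ φ ∧ (w = t ∨ Admissible P t w (φ - dist u w)) := by
  have su := tri_sum h u
  have sw := tri_sum h w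
  have st := tri_sum h t
  have hwP := (mem_of_adj hw).2
  have hd : dist u w ≤ tri i u - tri i w + (tri j w - tri j u) := by
    rcases hrule with ⟨⟨⟨h1, h2⟩, h3, h4⟩, -⟩ | ⟨-, h1, h2, h3⟩
    · have := dist_le_of_le h h1.le h3.le
      rw [dist_comm] at this
      linarith
    · have := dist_le_of_le h.rotate h2.le h1.le
      linarith
  have hwj : tri j w ≤ tri j t := by
    rcases hrule with ⟨⟨⟨h1, h2⟩, h3, h4⟩, -⟩ | ⟨-, h1, h2, h3⟩ <;> linarith
  have hwk : tri k w ≤ tri k t := by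
    rcases hrule with ⟨⟨⟨h1, h2⟩, h3, h4⟩, -⟩ | ⟨-, h1, h2, h3⟩ <;> linarith
  have hwi : tri i w < tri i u := by
    rcases hrule with ⟨⟨⟨h1, h2⟩, h3, h4⟩, -⟩ | ⟨-, h1, h2, h3⟩ <;> linarith
  have hempty : ∀ y ∈ P, ¬ InSide w t i j k y := by
    rintro y hy ⟨hy1, hy2, hy3⟩
    -- If `w` is in the middle, `u` is closest in the `i`-th cone of `w`, which forbids such a `z`
    -- with smaller `tri j`. If `w` is on the side, `w` is closest in the `j`-th cone of `u`.
    have hβ : ∀ z ∈ P, tri i z < tri i u → tri k z < tri k u → tri j w ≤ tri j z := by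
      intro z hz hzi hzk
      rcases hrule with ⟨⟨⟨h1, h2⟩, h3, h4⟩, -⟩ | ⟨-, h1, h2, h3⟩
      · by_contra! hlt
        have := tri_le_of_adj h hw.symm h1 h3 hz hlt (hzk.trans h3)
        linarith
      · exact tri_le_of_adj h.rotate hw h2 h1 hz hzk hzi
    -- A point violating emptiness yields a middle neighbor with smaller `tri j` than `w`, which the
    -- rule would have preferred.
    obtain ⟨z, hz, hzm, hzj⟩ := exists_adj_middle_lt hP h hu hside hwj hβ hy (by linarith) hy2 hy3
    have hzN : z ∈ kNeighborhood P 1 u := mem_kNeighborhood_one.2 (Or.inr hz)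
    rcases hrule with ⟨-, hmin⟩ | ⟨hno, -⟩
    · linarith [hmin z hzN hzm]
    · exact hno z hzN hzm
  refine ⟨by linarith, or_iff_not_imp_left.2 fun hne => ?_⟩
  exact ⟨i, j, k, h, Or.inr ⟨lt_of_le_of_ne hwj (hP.tri_ne hwP ht hne j),
    lt_of_le_of_ne hwk (hP.tri_ne hwP ht hne k), Or.inl ⟨hempty, by linarith⟩⟩⟩

/-- The gain of `tri j` pays for the edge, while the doubled term decreases. -/
theorem bothSides_progress {P : Finset Plane} (hP : GeneralPosition P) {i j k : Fin 3}
    (h : Distinct i j k) {t u w : Plane} {φ : ℝ} (ht : t ∈ P)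
    (htj : tri j u < tri j t) (htk : tri k u < tri k t)
    (hφ : 2 * (tri i u - tri i t) + (tri j t - tri j u) ≤ φ)
    (hw : (halfThetaSix P).Adj u w) (hrule : InSide u t i k j w) :
    dist u w ≤ φ ∧ (w = t ∨ Admissible P t w (φ - dist u w)) := by
  have su := tri_sum h u
  have st := tri_sum h t
  obtain ⟨h1, h2, h3⟩ := hrule
  have hd := dist_le_of_le h.rotate h2.le h1.le
  refine ⟨by linarith, or_iff_not_imp_left.2 fun hne => ?_⟩
  exact ⟨i, j, k, h, Or.inr ⟨lt_of_le_of_ne h3 (hP.tri_ne (mem_of_adj hw).2 ht hne j),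
    by linarith, Or.inr (by linarith)⟩⟩

theorem ForwardingRule.adj {P : Finset Plane} {t u w : Plane}
    (hw : ForwardingRule u t (kNeighborhood P 1 u) w) : (halfThetaSix P).Adj u w := by
  obtain ⟨hN, H⟩ := hw
  refine (mem_kNeighborhood_one.1 hN).resolve_left ?_
  rintro rfl
  rcases H with ⟨i, j, k, -, -, -, H, -⟩ | ⟨i, j, k, -, -, -, ⟨-, -, -, H, -⟩ |
    ⟨-, -, ⟨⟨⟨H, -⟩, -⟩, -⟩ | ⟨-, H, -⟩⟩⟩ <;> exact lt_irrefl _ H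

/-- The index `i` is the only one whose difference has the opposite sign. So the labelling used by
the rule and the one used by the potential agree up to exchanging `j` and `k`. -/
theorem Distinct.eq_of_negative {i j k i' j' k' : Fin 3} (h : Distinct i j k)
    (h' : Distinct i' j' k') {t u : Plane} (hj : tri j u < tri j t) (hk : tri k u < tri k t)
    (hj' : tri j' u < tri j' t) (hk' : tri k' u < tri k' t) :
    i' = i ∧ (j' = j ∧ k' = k ∨ j' = k ∧ k' = j) := by
  have su := tri_sum h u
  have st := tri_sum h t
  have hi : tri i t < tri i u := by linarith
  have h1 : j' ≠ i := by rintro rfl; linarith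
  have h2 : k' ≠ i := by rintro rfl; linarith
  revert h h' h1 h2
  clear * -
  revert i j k i' j' k'
  unfold Distinct
  decide

theorem Distinct.not_positive_negative {i j k i' j' k' : Fin 3} (h : Distinct i j k)
    (h' : Distinct i' j' k') {t u : Plane} (hj : tri j u < tri j t) (hk : tri k u < tri k t)
    (hj' : tri j' t < tri j' u) (hk' : tri k' t < tri k' u) : False := by
  have h1 : j' ≠ j := by rintro rfl; linarith
  have h2 : k' ≠ j := by rintro rfl; linarith
  have h3 : j' ≠ k := by rintro rfl; linarith
  have h4 : k' ≠ k := by rintro rfl; linarith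
  revert h h' h1 h2 h3 h4
  clear * -
  revert i j k i' j' k'
  unfold Distinct
  decide

/-- The potential decreases by at least the length of the edge that is followed. -/
theorem ForwardingRule.progress {P : Finset Plane} (hP : GeneralPosition P) {t u w : Plane}
    {φ : ℝ} (hu : u ∈ P) (ht : t ∈ P) (hφ : Admissible P t u φ)
    (hw : ForwardingRule u t (kNeighborhood P 1 u) w) :
    dist u w ≤ φ ∧ (w = t ∨ Admissible P t w (φ - dist u w)) := by
  have hadj := hw.adj
  obtain ⟨hN, H⟩ := hw
  obtain ⟨i, j, k, h, ⟨hj, hk, hφj, hφk⟩ | ⟨hj, hk, hφ⟩⟩ := hφ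
  · rcases H with ⟨i', j', k', h', hj', hk', hwj, hwk⟩ | ⟨i', j', k', h', hj', hk', -⟩
    · obtain ⟨rfl, ⟨rfl, rfl⟩ | ⟨rfl, rfl⟩⟩ := h.eq_of_negative h' hj hk hj' hk'
      · exact positiveRule_progress hP h ht hj hk hφj hφk hadj hwj hwk
      · exact positiveRule_progress hP h ht hj hk hφj hφk hadj hwk hwj
    · exact (h.not_positive_negative h' hj hk hj' hk').elim
  · rcases H with ⟨i', j', k', h', hj', hk', -, -⟩ | ⟨i', j', k', h', hj', hk', H⟩
    · exact (h.not_positive_negative h' hj hk hj' hk').elim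
    · have su := tri_sum h u
      have st := tri_sum h t
      obtain ⟨rfl, e⟩ := h.eq_of_negative h' hj hk hj' hk'
      rcases H with ⟨⟨x, hx, hxs⟩, ⟨y, hy, hys⟩, hle, hs⟩ | ⟨hno, hor, hrule⟩
      · have mem : ∀ {x}, x ∈ kNeighborhood P 1 u → x ∈ P := by
          intro x hx
          rcases mem_kNeighborhood_one.1 hx with rfl | hx
          · exact hu
          · exact (mem_of_adj hx).2
        -- With both sides occupied, the empty-side form of the potential is excluded. For exchanged
        -- labels, the rule's choice of the smaller side gives the bound.
        apply bothSides_progress hP h' ht hj' hk' _ hadj hs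
        rcases e with ⟨rfl, rfl⟩ | ⟨rfl, rfl⟩
        · rcases hφ with ⟨hφ, -⟩ | hφ
          · exact (hφ x (mem hx) hxs).elim
          · exact hφ
        · rcases hφ with ⟨hφ, -⟩ | hφ
          · exact (hφ y (mem hy) hys).elim
          · linarith
      · have hno' := forall_not_inSide hP h' hu hno
        apply emptySide_progress hP h' hu ht hk' hno' _ hadj hrule
        rcases e with ⟨rfl, rfl⟩ | ⟨rfl, rfl⟩
        · rcases hφ with ⟨-, hφ⟩ | hφ <;> linarith
        -- Rule and potential name opposite sides. If the potential relies on an empty side, both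
        -- sides are empty, and the tie-break `hor` makes the rule's potential the smaller one.
        · rcases hφ with ⟨hφ, hφ'⟩ | hφ
          · rcases hor with ⟨y, hy, hys⟩ | hle
            · refine (hφ y ?_ hys).elim
              rcases mem_kNeighborhood_one.1 hy with rfl | hx
              · exact hu
              · exact (mem_of_adj hx).2
            · linarith
          · linarith

/-! ### The rule always applies. -/

theorem pos_or_neg {P : Finset Plane} (hP : GeneralPosition P) {t u : Plane}
    (hu : u ∈ P) (ht : t ∈ P) (hne : u ≠ t) :
    (∃ i j k, Distinct i j k ∧ tri j t < tri j u ∧ tri k t < tri k u) ∨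
      (∃ i j k, Distinct i j k ∧ tri j u < tri j t ∧ tri k u < tri k t) := by
  have h := distinct_zero_one_two
  rcases lt_or_gt_of_ne (hP.tri_ne hu ht hne 0) with h0 | h0 <;>
  rcases lt_or_gt_of_ne (hP.tri_ne hu ht hne 1) with h1 | h1 <;>
  rcases lt_or_gt_of_ne (hP.tri_ne hu ht hne 2) with h2 | h2
  -- Three equal signs contradict the zero sum, but this pattern and its opposite satisfy a
  -- conclusion anyway.
  · exact Or.inr ⟨0, 1, 2, h, h1, h2⟩
  · exact Or.inr ⟨2, 0, 1, h.rotate.rotate, h0, h1⟩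
  · exact Or.inr ⟨1, 2, 0, h.rotate, h2, h0⟩
  · exact Or.inl ⟨0, 1, 2, h, h1, h2⟩
  · exact Or.inr ⟨0, 1, 2, h, h1, h2⟩
  · exact Or.inl ⟨1, 2, 0, h.rotate, h2, h0⟩
  · exact Or.inl ⟨2, 0, 1, h.rotate.rotate, h0, h1⟩
  · exact Or.inl ⟨0, 1, 2, h, h1, h2⟩

theorem exists_min_neighbor {P : Finset Plane} {u : Plane} (j : Fin 3) (Q : Plane → Prop)
    (hex : ∃ x ∈ kNeighborhood P 1 u, Q x) :
    ∃ w ∈ kNeighborhood P 1 u, Q w ∧ ∀ x ∈ kNeighborhood P 1 u, Q x → tri j w ≤ tri j x := by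
  classical
  have hsub : kNeighborhood P 1 u ⊆ (insert u P : Finset Plane) := by
    intro x hx
    rcases mem_kNeighborhood_one.1 hx with rfl | hx
    · simp
    · simp [(mem_of_adj hx).2]
  obtain ⟨x, hx, hQ⟩ := hex
  obtain ⟨w, hw, hmin⟩ := Finset.exists_min_image
    ((insert u P).filter fun y => y ∈ kNeighborhood P 1 u ∧ Q y) (tri j)
    ⟨x, Finset.mem_filter.2 ⟨hsub hx, hx, hQ⟩⟩
  rw [Finset.mem_filter] at hw
  exact ⟨w, hw.2.1, hw.2.2, fun y hy hyQ => hmin y (Finset.mem_filter.2 ⟨hsub hy, hy, hyQ⟩)⟩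

theorem exists_emptySideRule {P : Finset Plane} (hP : GeneralPosition P) {i j k : Fin 3}
    (h : Distinct i j k) {t u : Plane} (hu : u ∈ P) (ht : t ∈ P)
    (htj : tri j u < tri j t) (htk : tri k u < tri k t)
    (hno : ∀ x ∈ kNeighborhood P 1 u, ¬ InSide u t i j k x)
    (hor : (∃ x ∈ kNeighborhood P 1 u, InSide u t i k j x) ∨
      tri j t - tri j u ≤ tri k t - tri k u) :
    ∃ w ∈ kNeighborhood P 1 u, EmptySideRule u t (kNeighborhood P 1 u) i j k w := by
  by_cases hm : ∃ x ∈ kNeighborhood P 1 u, InMiddle u t j k x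
  · obtain ⟨w, hw, hwm, hmin⟩ := exists_min_neighbor j _ hm
    exact ⟨w, hw, hno, hor, Or.inl ⟨hwm, hmin⟩⟩
  · by_cases hs : ∃ x ∈ kNeighborhood P 1 u, InSide u t i k j x
    · obtain ⟨w, hw, hws⟩ := hs
      push Not at hm
      exact ⟨w, hw, hno, hor, Or.inr ⟨hm, hws⟩⟩
    · exfalso
      push Not at hs
      have hno' := forall_not_inSide hP h hu hno
      have hs' := forall_not_inSide hP h.swap hu hs
      -- With both sides empty, `t` itself witnesses that the middle is occupied, hence contains a
      -- neighbor.
      obtain ⟨y, hy, hym, -⟩ := exists_adj_middle hP h (t := t) hu (fun _ => True)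
        ⟨t, ht, ⟨⟨htj, le_rfl⟩, htk, le_rfl⟩, trivial⟩ (by
          intro y hy hm' _ z hz hzj hzk hzi
          have hne : z ≠ u := by rintro rfl; exact lt_irrefl _ hzi
          refine ⟨⟨⟨?_, hzj.le.trans hm'.1.2⟩, ?_, hzk.le.trans hm'.2.2⟩, trivial⟩
          · exact lt_of_le_of_ne
              (not_lt.1 fun hlt => hno' z hz ⟨hzi, hlt, hzk.le.trans hm'.2.2⟩)
              (hP.tri_ne hz hu hne j).symm
          · exact lt_of_le_of_ne
              (not_lt.1 fun hlt => hs' z hz ⟨hzi, hlt, hzj.le.trans hm'.1.2⟩)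
              (hP.tri_ne hz hu hne k).symm)
      exact hm ⟨y, mem_kNeighborhood_one.2 (Or.inr hy), hym⟩

theorem exists_forwardingRule {P : Finset Plane} (hP : GeneralPosition P) {t u : Plane}
    (hu : u ∈ P) (ht : t ∈ P) (hne : u ≠ t) :
    ∃ w, ForwardingRule u t (kNeighborhood P 1 u) w := by
  rcases pos_or_neg hP hu ht hne with ⟨i, j, k, h, hj, hk⟩ | ⟨i, j, k, h, hj, hk⟩
  · obtain ⟨v, hv, hvj, hvk⟩ := exists_adj_of_mem_cone hP h hu ht hj hk
    exact ⟨v, mem_kNeighborhood_one.2 (Or.inr hv), Or.inl ⟨i, j, k, h, hj, hk, hvj, hvk⟩⟩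
  · have wlog_le : ∀ j k, Distinct i j k → tri j u < tri j t → tri k u < tri k t →
        tri j t - tri j u ≤ tri k t - tri k u →
        ∃ w, ForwardingRule u t (kNeighborhood P 1 u) w := by
      intro j k h hj hk hle
      by_cases hsk : ∃ x ∈ kNeighborhood P 1 u, InSide u t i j k x
      · by_cases hsj : ∃ x ∈ kNeighborhood P 1 u, InSide u t i k j x
        · have hsj' := hsj
          obtain ⟨w, hw, hws⟩ := hsj'
          exact ⟨w, hw, Or.inr ⟨i, j, k, h, hj, hk, Or.inl ⟨hsk, hsj, hle, hws⟩⟩⟩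
        · push Not at hsj
          obtain ⟨w, hw, hr⟩ := exists_emptySideRule hP h.swap hu ht hk hj hsj (Or.inl hsk)
          exact ⟨w, hw, Or.inr ⟨i, k, j, h.swap, hk, hj, Or.inr hr⟩⟩
      · push Not at hsk
        obtain ⟨w, hw, hr⟩ := exists_emptySideRule hP h hu ht hj hk hsk (Or.inr hle)
        exact ⟨w, hw, Or.inr ⟨i, j, k, h, hj, hk, Or.inr hr⟩⟩
    rcases le_total (tri j t - tri j u) (tri k t - tri k u) with hle | hle
    · exact wlog_le j k h hj hk hle
    · exact wlog_le k j h.swap hk hj hle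

theorem router_spec {P : Finset Plane} (hP : GeneralPosition P) {t u : Plane}
    (hu : u ∈ P) (ht : t ∈ P) (hne : u ≠ t) :
    ForwardingRule u t (kNeighborhood P 1 u) (router u t (kNeighborhood P 1 u)) := by
  have hex := exists_forwardingRule hP hu ht hne
  unfold router
  rw [dif_pos hex]
  exact hex.choose_spec

/-! ### Delivery and the upper bounds on the routing ratios. -/

theorem position_succ (k : ℕ) (A : RoutingAlgorithm) (P : Finset Plane) (s t : Plane) (n : ℕ) :
    position k A P s t (n + 1) = position k A P (A s t (kNeighborhood P k s)) t n := by
  simp [position, Function.iterate_succ_apply]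

theorem deliversWithin_self (k : ℕ) (A : RoutingAlgorithm) (P : Finset Plane) (t : Plane) {L : ℝ}
    (hL : 0 ≤ L) : DeliversWithin k A P t t L :=
  ⟨0, rfl, by simp, by simpa using hL⟩

theorem DeliversWithin.cons {k : ℕ} {A : RoutingAlgorithm} {P : Finset Plane} {s t : Plane} {L : ℝ}
    (hne : s ≠ t) (hadj : (halfThetaSix P).Adj s (A s t (kNeighborhood P k s)))
    (h : DeliversWithin k A P (A s t (kNeighborhood P k s)) t
      (L - dist s (A s t (kNeighborhood P k s)))) :
    DeliversWithin k A P s t L := by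
  obtain ⟨n, h1, h2, h3⟩ := h
  refine ⟨n + 1, by rw [position_succ, h1], ?_, ?_⟩
  · intro i hi
    cases i with
    | zero =>
      rw [position_succ]
      exact ⟨hne, hadj⟩
    | succ i =>
      rw [position_succ, position_succ]
      exact h2 i (by omega)
  · rw [Finset.sum_range_succ']
    simp only [position_succ]
    simp only [position_succ] at h3
    have e : ∀ x, position k A P x t 0 = x := fun _ => rfl
    rw [e, e]
    linarith

theorem exists_pos_le_dist (P : Finset Plane) :
    ∃ δ > 0, ∀ p ∈ P, ∀ q ∈ P, p ≠ q → δ ≤ dist p q := by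
  classical
  rcases (P.offDiag).eq_empty_or_nonempty with he | hne
  · refine ⟨1, one_pos, fun p hp q hq hpq => ?_⟩
    have : (p, q) ∈ P.offDiag := Finset.mem_offDiag.2 ⟨hp, hq, hpq⟩
    simp [he] at this
  · obtain ⟨x, hx, hmin⟩ := Finset.exists_min_image P.offDiag (fun x => dist x.1 x.2) hne
    refine ⟨dist x.1 x.2, dist_pos.2 (Finset.mem_offDiag.1 hx).2.2, fun p hp q hq hpq => ?_⟩
    exact hmin (p, q) (Finset.mem_offDiag.2 ⟨hp, hq, hpq⟩)

theorem router_delivers {P : Finset Plane} (hP : GeneralPosition P) {t u : Plane} {φ : ℝ}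
    (hu : u ∈ P) (ht : t ∈ P) (hφ : Admissible P t u φ) : DeliversWithin 1 router P u t φ := by
  obtain ⟨δ, hδ, hmin⟩ := exists_pos_le_dist P
  -- Each edge has length at least `δ`, so a potential below `n * δ` leaves fewer than `n` steps.
  -- This gives termination.
  have key : ∀ n : ℕ, ∀ u ∈ P, ∀ φ, Admissible P t u φ → φ < n * δ →
      DeliversWithin 1 router P u t φ := by
    intro n
    induction n with
    | zero =>
      intro u hu φ hφ hlt
      have := hφ.nonneg
      simp at hlt
      linarith
    | succ n ih =>
      intro u hu φ hφ hlt
      have hr := router_spec hP hu ht hφ.ne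
      have hadj := hr.adj
      obtain ⟨hd, hor⟩ := hr.progress hP hu ht hφ
      refine DeliversWithin.cons hφ.ne hadj ?_
      rcases hor with he | hA
      · rw [he]
        rw [he] at hd
        exact deliversWithin_self _ _ _ _ (by linarith)
      · refine ih _ (mem_of_adj hadj).2 _ hA ?_
        have := hmin _ hu _ (mem_of_adj hadj).2 hadj.ne
        push_cast at hlt
        linarith
  obtain ⟨n, hn⟩ := exists_nat_gt (φ / δ)
  exact key n u hu φ hφ ((div_lt_iff₀ hδ).1 hn)

theorem admissible_of_inPositiveCone {P : Finset Plane} (hP : GeneralPosition P) {t u : Plane}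
    (hu : u ∈ P) (ht : t ∈ P) (hne : u ≠ t) (h : InPositiveCone u t) :
    Admissible P t u (2 * dist u t) := by
  obtain ⟨i, hi⟩ := h
  obtain ⟨j, k, h⟩ := exists_distinct i
  rw [mem_positiveCone_iff h] at hi
  have hj := lt_of_le_of_ne hi.1 (hP.tri_ne ht hu hne.symm j)
  have hk := lt_of_le_of_ne hi.2 (hP.tri_ne ht hu hne.symm k)
  have su := tri_sum h u
  have st := tri_sum h t
  have hd := dist_sq_eq h u t
  refine ⟨i, j, k, h, Or.inl ⟨hj, hk, ?_, ?_⟩⟩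
  · rw [show tri i t - tri i u + (tri j u - tri j t) =
      2 * (tri j u - tri j t) + (tri k u - tri k t) by linarith]
    -- Here `(2a + b)² = 4 (a² + ab + b²) - 3b²`.
    refine le_of_sq_le_sq ?_ (by positivity)
    rw [mul_pow, hd]
    nlinarith [sq_nonneg (tri k u - tri k t)]
  · rw [show tri i t - tri i u + (tri k u - tri k t) =
      (tri j u - tri j t) + 2 * (tri k u - tri k t) by linarith]
    refine le_of_sq_le_sq ?_ (by positivity)
    rw [mul_pow, hd]
    nlinarith [sq_nonneg (tri j u - tri j t)]

theorem admissible_of_inNegativeCone {P : Finset Plane} (hP : GeneralPosition P) {t u : Plane}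
    (hu : u ∈ P) (ht : t ∈ P) (hne : u ≠ t) (h : InNegativeCone u t) :
    Admissible P t u (5 / √3 * dist u t) := by
  obtain ⟨i, hi⟩ := (inNegativeCone_iff u t).1 h
  obtain ⟨j, k, h⟩ := exists_distinct i
  rw [mem_positiveCone_iff h] at hi
  have hj := lt_of_le_of_ne hi.1 (hP.tri_ne hu ht hne j)
  have hk := lt_of_le_of_ne hi.2 (hP.tri_ne hu ht hne k)
  have wlog_le : ∀ j k, Distinct i j k → tri j u < tri j t → tri k u < tri k t →
      tri j t - tri j u ≤ tri k t - tri k u → Admissible P t u (5 / √3 * dist u t) := by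
    intro j k h hj hk hle
    have su := tri_sum h u
    have st := tri_sum h t
    have hd := dist_sq_eq h u t
    refine ⟨i, j, k, h, Or.inr ⟨hj, hk, Or.inr ?_⟩⟩
    rw [show 2 * (tri i u - tri i t) + (tri j t - tri j u) =
      3 * (tri j t - tri j u) + 2 * (tri k t - tri k u) by linarith]
    refine le_of_sq_le_sq ?_ (by positivity)
    rw [mul_pow, hd, div_pow, Real.sq_sqrt (by norm_num : (0 : ℝ) ≤ 3)]
    have hj0 : 0 < tri j t - tri j u := by linarith
    have hk0 : 0 < tri k t - tri k u := by linarith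
    -- With `a ≤ b`, the difference `25/3 (a² + ab + b²) - (3a + 2b)²` equals `(2a + 13b)(b - a) /
    -- 3`; equality holds when `a = b`, the midpoint configuration.
    have := mul_nonneg (by positivity : 0 ≤ 2 * (tri j t - tri j u) + 13 * (tri k t - tri k u))
      (sub_nonneg.2 hle)
    nlinarith
  rcases le_total (tri j t - tri j u) (tri k t - tri k u) with hle | hle
  · exact wlog_le j k h hj hk hle
  · exact wlog_le k j h.swap hk hj hle

theorem inPositiveCone_or_inNegativeCone {P : Finset Plane} (hP : GeneralPosition P)
    {t u : Plane} (hu : u ∈ P) (ht : t ∈ P) (hne : u ≠ t) :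
    InPositiveCone u t ∨ InNegativeCone u t := by
  rw [inNegativeCone_iff]
  rcases pos_or_neg hP hu ht hne with ⟨i, j, k, h, hj, hk⟩ | ⟨i, j, k, h, hj, hk⟩
  · exact Or.inl ⟨i, (mem_positiveCone_iff h).2 ⟨hj.le, hk.le⟩⟩
  · exact Or.inr ⟨i, (mem_positiveCone_iff h).2 ⟨hj.le, hk.le⟩⟩

theorem two_lt_five_div_sqrt_three : (2 : ℝ) < 5 / √3 := by
  rw [lt_div_iff₀ (by positivity)]
  nlinarith [Real.sq_sqrt (by norm_num : (0 : ℝ) ≤ 3), Real.sqrt_nonneg 3]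

theorem router_competitive_positive : IsCompetitive 1 router InPositiveCone 2 :=
  fun _ hP _ hs _ ht hne h =>
    router_delivers hP hs ht (admissible_of_inPositiveCone hP hs ht hne h)

theorem router_competitive_negative : IsCompetitive 1 router InNegativeCone (5 / √3) :=
  fun _ hP _ hs _ ht hne h =>
    router_delivers hP hs ht (admissible_of_inNegativeCone hP hs ht hne h)

theorem DeliversWithin.mono {k : ℕ} {A : RoutingAlgorithm} {P : Finset Plane} {s t : Plane}
    {L L' : ℝ} (h : DeliversWithin k A P s t L) (hL : L ≤ L') : DeliversWithin k A P s t L' := by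
  obtain ⟨n, h1, h2, h3⟩ := h
  exact ⟨n, h1, h2, h3.trans hL⟩

theorem router_competitive : IsCompetitive 1 router (fun _ _ => True) (5 / √3) := by
  intro P hP s hs t ht hne _
  rcases inPositiveCone_or_inNegativeCone hP hs ht hne with h | h
  · exact (router_competitive_positive P hP s hs t ht hne h).mono
      (mul_le_mul_of_nonneg_right two_lt_five_div_sqrt_three.le dist_nonneg)
  · exact router_competitive_negative P hP s hs t ht hne h

/-! ### Walks, the lower bound for positive cones and the spanning ratio. -/

theorem DeliversWithin.uncons {k : ℕ} {A : RoutingAlgorithm} {P : Finset Plane} {s t : Plane}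
    {L : ℝ} (h : DeliversWithin k A P s t L) (hne : s ≠ t) :
    (halfThetaSix P).Adj s (A s t (kNeighborhood P k s)) ∧
      DeliversWithin k A P (A s t (kNeighborhood P k s)) t
        (L - dist s (A s t (kNeighborhood P k s))) := by
  obtain ⟨n, h1, h2, h3⟩ := h
  cases n with
  | zero => exact absurd h1 hne
  | succ n =>
    have e : ∀ x, position k A P x t 0 = x := fun _ => rfl
    rw [position_succ] at h1
    refine ⟨(h2 0 (by omega)).2, n, h1, fun i hi => ?_, ?_⟩
    · have := h2 (i + 1) (by omega)
      rwa [position_succ, position_succ] at this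
    · rw [Finset.sum_range_succ'] at h3
      simp only [position_succ] at h3
      rw [e, e] at h3
      simp only [position_succ]
      linarith

theorem walkLength_cons {G : SimpleGraph Plane} {u v w : Plane} (h : G.Adj u v) (p : G.Walk v w) :
    walkLength (p.cons h) = dist u v + walkLength p := by
  simp [walkLength]

theorem walkLength_reverse {G : SimpleGraph Plane} {u v : Plane} (p : G.Walk u v) :
    walkLength p.reverse = walkLength p := by
  simp only [walkLength, SimpleGraph.Walk.darts_reverse, List.map_reverse, List.sum_reverse,
    List.map_map]
  congr 1
  apply List.map_congr_left
  intro e _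
  simp [dist_comm]

theorem DeliversWithin.exists_walk {k : ℕ} {A : RoutingAlgorithm} {P : Finset Plane} {s t : Plane}
    {L : ℝ} (h : DeliversWithin k A P s t L) :
    ∃ p : (halfThetaSix P).Walk s t, walkLength p ≤ L := by
  obtain ⟨n, h1, h2, h3⟩ := h
  induction n generalizing s L with
  | zero =>
    have : s = t := h1
    subst this
    exact ⟨.nil, by simpa [walkLength] using h3⟩
  | succ n ih =>
    rw [position_succ] at h1
    rw [Finset.sum_range_succ'] at h3
    simp only [position_succ] at h3
    obtain ⟨p, hp⟩ := ih h1 (fun i hi => by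
      have := h2 (i + 1) (by omega)
      rwa [position_succ, position_succ] at this) (by
      simp only [position_succ]
      exact le_sub_iff_add_le.2 h3)
    have hadj : (halfThetaSix P).Adj s (A s t (kNeighborhood P k s)) := (h2 0 (by omega)).2
    refine ⟨p.cons hadj, ?_⟩
    rw [walkLength_cons]
    exact le_sub_iff_add_le'.1 hp

/-- A walk to a vertex with a single neighbor passes through this neighbor. -/
theorem dist_add_dist_le_walkLength {G : SimpleGraph Plane} {u t v : Plane}
    (hv : ∀ x, G.Adj x t → x = v) (p : G.Walk u t) (hne : u ≠ t) :
    dist u v + dist v t ≤ walkLength p := by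
  induction p with
  | nil => exact absurd rfl hne
  | @cons u w t h q ih =>
    rw [walkLength_cons]
    by_cases hw : w = t
    · subst hw
      obtain rfl := hv _ h
      have : 0 ≤ walkLength q := by
        unfold walkLength
        apply List.sum_nonneg
        intro x hx
        obtain ⟨e, -, rfl⟩ := List.mem_map.1 hx
        exact dist_nonneg
      simp only [dist_self]
      linarith
    · have := ih hv hw
      linarith [dist_triangle u w v]

/-- `t` and `b` sit near the two ends of the side opposite `s` in a unit triangle. As `b` is
slightly closer, `s` gets no edge to `t`, and any walk must make two moves of length almost `1`. -/
theorem exists_long_positive {ε : ℝ} (hε : 0 < ε) (hε' : ε ≤ 1 / 10) :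
    ∃ P : Finset Plane, GeneralPosition P ∧ ∃ s ∈ P, ∃ t ∈ P, s ≠ t ∧ InPositiveCone s t ∧
      dist s t ≤ 1 ∧ ∀ p : (halfThetaSix P).Walk s t, 2 - 4 * ε ≤ walkLength p := by
  classical
  set s : Plane := ofTri 0 0 with hs
  set t : Plane := ofTri (-ε) (-1 + ε) with ht
  set b : Plane := ofTri (-1 + 2 * ε) (-ε) with hb
  have s0 : tri 0 s = 0 := by rw [hs, tri_zero_ofTri]; ring
  have s1 : tri 1 s = 0 := tri_one_ofTri _ _
  have s2 : tri 2 s = 0 := tri_two_ofTri _ _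
  have t0 : tri 0 t = 1 := by rw [ht, tri_zero_ofTri]; ring
  have t1 : tri 1 t = -ε := tri_one_ofTri _ _
  have t2 : tri 2 t = -1 + ε := tri_two_ofTri _ _
  have b0 : tri 0 b = 1 - ε := by rw [hb, tri_zero_ofTri]; ring
  have b1 : tri 1 b = -1 + 2 * ε := tri_one_ofTri _ _
  have b2 : tri 2 b = -ε := tri_two_ofTri _ _
  have hst : s ≠ t := by intro h; rw [h, t0] at s0; linarith
  refine ⟨{s, t, b}, ?_, s, by simp, t, by simp, hst, ?_, ?_, ?_⟩
  · rw [generalPosition_iff]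
    intro p hp q hq hne i he
    simp only [Finset.mem_insert, Finset.mem_singleton] at hp hq
    rcases hp with rfl | rfl | rfl <;> rcases hq with rfl | rfl | rfl <;>
      first
      | exact hne rfl
      | (fin_cases i <;> simp only [Fin.zero_eta, Fin.mk_one, Fin.reduceFinMk] at he <;> linarith)
  · refine ⟨0, (mem_positiveCone_iff distinct_zero_one_two).2 ⟨?_, ?_⟩⟩ <;> linarith
  · have := dist_le_of_le distinct_zero_one_two (u := s) (v := t) (by linarith) (by linarith)
    linarith
  · intro p
    have hv : ∀ x, (halfThetaSix {s, t, b}).Adj x t → x = b := by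
      intro x hx
      have hxP := (mem_of_adj hx).1
      simp only [Finset.mem_insert, Finset.mem_singleton] at hxP
      rcases hxP with rfl | rfl | rfl
      · have := tri_le_of_adj distinct_zero_one_two (x := b) hx (by linarith) (by linarith)
          (by simp) (by linarith) (by linarith)
        linarith
      · exact absurd rfl hx.ne
      · rfl
    have h1 := dist_add_dist_le_walkLength hv p hst
    have h2 := half_sub_le_dist distinct_zero_one_two.rotate.rotate s b
    have h3 := half_sub_le_dist distinct_zero_one_two b t
    linarith

theorem two_le_of_competitive_positive {k : ℕ} {A : RoutingAlgorithm} {d : ℝ}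
    (h : IsCompetitive k A InPositiveCone d) : 2 ≤ d := by
  have key : ∀ ε : ℝ, 0 < ε → ε ≤ 1 / 10 → 2 - 4 * ε ≤ d := by
    intro ε hε hε'
    obtain ⟨P, hP, s, hs, t, ht, hne, hpos, hd, hw⟩ := exists_long_positive hε hε'
    obtain ⟨p, hp⟩ := (h P hP s hs t ht hne hpos).exists_walk
    have h1 := (hw p).trans hp
    have h2 : 0 < dist s t := dist_pos.2 hne
    have h3 : 0 < d := by
      by_contra! h0
      nlinarith
    nlinarith
  by_contra! hlt
  rcases le_total (1 / 10) ((2 - d) / 8) with hle | hle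
  · have := key (1 / 10) (by norm_num) le_rfl
    linarith
  · have := key ((2 - d) / 8) (by linarith) hle
    linarith

theorem isSpanningRatio_two : IsSpanningRatio 2 := by
  constructor
  · refine ⟨by norm_num, fun P hP u hu v hv => ?_⟩
    suffices ∃ p : (halfThetaSix P).Walk u v, walkLength p ≤ 2 * dist u v by
      obtain ⟨p, hp⟩ := this
      exact (iInf_le _ p).trans (ENNReal.ofReal_le_ofReal hp)
    rcases eq_or_ne u v with rfl | hne
    · exact ⟨.nil, by simp [walkLength]⟩
    rcases inPositiveCone_or_inNegativeCone hP hu hv hne with h | h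
    · exact (router_competitive_positive P hP u hu v hv hne h).exists_walk
    -- Path length is symmetric: the route is taken from `v`, which sees `u` in a positive cone, and
    -- reversed.
    · obtain ⟨p, hp⟩ := (router_competitive_positive P hP v hv u hu hne.symm
        ((inNegativeCone_iff u v).1 h)).exists_walk
      exact ⟨p.reverse, by rwa [walkLength_reverse, dist_comm]⟩
  · rintro r ⟨hr1, hr⟩
    have key : ∀ ε : ℝ, 0 < ε → ε ≤ 1 / 10 → 2 - 4 * ε ≤ r := by
      intro ε hε hε'
      obtain ⟨P, hP, s, hs, t, ht, hne, hpos, hd, hw⟩ := exists_long_positive hε hε'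
      have h1 : ENNReal.ofReal (2 - 4 * ε) ≤ ENNReal.ofReal (r * dist s t) :=
        (le_iInf fun p => ENNReal.ofReal_le_ofReal (hw p)).trans (hr P hP s hs t ht)
      rw [ENNReal.ofReal_le_ofReal_iff (by positivity)] at h1
      nlinarith
    by_contra! hlt
    have := key ((2 - r) / 10) (by linarith) (by linarith)
    linarith

/-! ### The alternating chain. -/

/-- Minus the larger of the last two triangular coordinates of the `n`-th vertex of the chain. -/
def chainNear (K : ℕ) (ε : ℝ) (n : ℕ) : ℝ := if n = 0 then 1 / 2 else (K - n) * ε / 2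

/-- Minus the smaller of the last two triangular coordinates of the `n`-th vertex of the chain. -/
def chainFar (K : ℕ) (ε : ℝ) (n : ℕ) : ℝ := if n = 0 then 1 / 2 else 1 - (K + n) * ε / 2

/-- The index of the larger of the last two triangular coordinates. -/
def nearIdx (n : ℕ) : Fin 3 := if Even n then 2 else 1

/-- The index of the smaller of the last two triangular coordinates. -/
def farIdx (n : ℕ) : Fin 3 := if Even n then 1 else 2

/-- A sequence of points that starts halfway between two corners of a triangle and then alternates
between points near these corners. -/
def chain (K : ℕ) (ε : ℝ) (n : ℕ) : Plane :=
  if Even n then ofTri (-chainFar K ε n) (-chainNear K ε n)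
  else ofTri (-chainNear K ε n) (-chainFar K ε n)

open Classical in
/-- The third corner of the triangle together with the first vertices of the chain. -/
def chainSet (K : ℕ) (ε : ℝ) (M : ℕ) : Finset Plane :=
  insert 0 ((Finset.range (M + 1)).image (chain K ε))

theorem distinct_near_far (n : ℕ) : Distinct 0 (nearIdx n) (farIdx n) := by
  unfold nearIdx farIdx Distinct
  split_ifs <;> decide

theorem nearIdx_eq_of_even_iff {m n : ℕ} (h : Even m ↔ Even n) : nearIdx m = nearIdx n := by
  simp [nearIdx, h]

theorem farIdx_eq_of_even_iff {m n : ℕ} (h : Even m ↔ Even n) : farIdx m = farIdx n := by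
  simp [farIdx, h]

theorem nearIdx_eq_farIdx {m n : ℕ} (h : ¬ (Even m ↔ Even n)) : nearIdx m = farIdx n := by
  by_cases hm : Even m <;> by_cases hn : Even n <;> simp_all [nearIdx, farIdx]

theorem farIdx_eq_nearIdx {m n : ℕ} (h : ¬ (Even m ↔ Even n)) : farIdx m = nearIdx n := by
  by_cases hm : Even m <;> by_cases hn : Even n <;> simp_all [nearIdx, farIdx]

section Chain

variable {K : ℕ} {ε : ℝ}

theorem tri_near_chain (n : ℕ) : tri (nearIdx n) (chain K ε n) = -chainNear K ε n := by
  unfold nearIdx chain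
  split_ifs
  · exact tri_two_ofTri _ _
  · exact tri_one_ofTri _ _

theorem tri_far_chain (n : ℕ) : tri (farIdx n) (chain K ε n) = -chainFar K ε n := by
  unfold farIdx chain
  split_ifs
  · exact tri_one_ofTri _ _
  · exact tri_two_ofTri _ _

theorem tri_zero_chain (n : ℕ) : tri 0 (chain K ε n) = 1 - n * ε := by
  have h := tri_sum (distinct_near_far n) (chain K ε n)
  rw [tri_near_chain, tri_far_chain] at h
  unfold chainNear chainFar at h
  split_ifs at h with h0
  · subst h0; simp; linarith
  · linarith

theorem chainNear_le {n : ℕ} (hε : 0 < ε) (hK : K * ε ≤ 1 / 4) (hn : n ≠ 0) :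
    chainNear K ε n ≤ 1 / 8 := by
  have : 0 ≤ n * ε := by positivity
  rw [chainNear, if_neg hn]
  linarith

theorem chainNear_pos {n : ℕ} (hε : 0 < ε) (hn : n < K) : 0 < chainNear K ε n := by
  have : (n : ℝ) < K := by exact_mod_cast hn
  unfold chainNear
  split_ifs
  · norm_num
  · have : (0 : ℝ) < K - n := by linarith
    positivity

theorem chainFar_ge {n : ℕ} (hε : 0 < ε) (hK : K * ε ≤ 1 / 4) (hn : n ≠ 0) (hnK : n < K) :
    3 / 4 ≤ chainFar K ε n := by
  have : (n : ℝ) < K := by exact_mod_cast hnK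
  have : n * ε ≤ K * ε := by nlinarith
  rw [chainFar, if_neg hn]
  linarith

theorem chainNear_lt {m n : ℕ} (hε : 0 < ε) (hK : K * ε ≤ 1 / 4) (hmn : m < n) :
    chainNear K ε n < chainNear K ε m := by
  rcases eq_or_ne m 0 with rfl | hm
  · have := chainNear_le hε hK (show n ≠ 0 by omega)
    have e : chainNear K ε 0 = 1 / 2 := by simp [chainNear]
    linarith
  · have : (m : ℝ) < n := by exact_mod_cast hmn
    rw [chainNear, chainNear, if_neg hm, if_neg (by omega)]
    nlinarith

theorem chainFar_lt {m n : ℕ} (hε : 0 < ε) (hm : m ≠ 0) (hmn : m < n) :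
    chainFar K ε n < chainFar K ε m := by
  have : (m : ℝ) < n := by exact_mod_cast hmn
  rw [chainFar, chainFar, if_neg hm, if_neg (by omega)]
  nlinarith

theorem chainNear_zero : chainNear K ε 0 = 1 / 2 := by simp [chainNear]

theorem chainFar_zero : chainFar K ε 0 = 1 / 2 := by simp [chainFar]

theorem tri_zero_chain_lt_iff {m n : ℕ} (hε : 0 < ε) :
    tri 0 (chain K ε n) < tri 0 (chain K ε m) ↔ m < n := by
  rw [tri_zero_chain, tri_zero_chain]
  constructor
  · intro h
    have : (m : ℝ) < n := by nlinarith
    exact_mod_cast this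
  · intro h
    have : (m : ℝ) < n := by exact_mod_cast h
    nlinarith

theorem tri_zero_chain_pos {n : ℕ} (hε : 0 < ε) (hK : K * ε ≤ 1 / 4) (hn : n < K) :
    0 < tri 0 (chain K ε n) := by
  have : (n : ℝ) < K := by exact_mod_cast hn
  rw [tri_zero_chain]
  linarith [mul_lt_mul_of_pos_right this hε]

theorem chain_injective (hε : 0 < ε) : Function.Injective (chain K ε) := by
  intro m n h
  rcases lt_trichotomy m n with hlt | he | hlt
  · have := (tri_zero_chain_lt_iff (K := K) hε).2 hlt
    rw [h] at this
    exact absurd this (lt_irrefl _)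
  · exact he
  · have := (tri_zero_chain_lt_iff (K := K) hε).2 hlt
    rw [h] at this
    exact absurd this (lt_irrefl _)

theorem mem_chainSet {M : ℕ} {x : Plane} :
    x ∈ chainSet K ε M ↔ x = 0 ∨ ∃ n ≤ M, x = chain K ε n := by
  classical
  simp only [chainSet, Finset.mem_insert, Finset.mem_image, Finset.mem_range, Nat.lt_succ_iff]
  simp only [eq_comm]

theorem chain_mem_chainSet {M n : ℕ} (h : n ≤ M) : chain K ε n ∈ chainSet K ε M :=
  mem_chainSet.2 (Or.inr ⟨n, h, rfl⟩)

theorem chainFar_pos {n : ℕ} (hε : 0 < ε) (hK : K * ε ≤ 1 / 4) (hn : n < K) :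
    0 < chainFar K ε n := by
  rcases eq_or_ne n 0 with rfl | h0
  · rw [chainFar_zero]; norm_num
  · linarith [chainFar_ge hε hK h0 hn]

theorem chainNear_le_half {n : ℕ} (hε : 0 < ε) (hK : K * ε ≤ 1 / 4) :
    chainNear K ε n ≤ 1 / 2 := by
  rcases eq_or_ne n 0 with rfl | h0
  · rw [chainNear_zero]
  · linarith [chainNear_le hε hK h0]

theorem half_le_chainFar {n : ℕ} (hε : 0 < ε) (hK : K * ε ≤ 1 / 4) (hn : n < K) :
    1 / 2 ≤ chainFar K ε n := by
  rcases eq_or_ne n 0 with rfl | h0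
  · rw [chainFar_zero]
  · linarith [chainFar_ge hε hK h0 hn]

theorem tri_chain_ne {m n : ℕ} (hε : 0 < ε) (hK : K * ε ≤ 1 / 4) (hmn : m < n) (hn : n < K)
    (i : Fin 3) : tri i (chain K ε m) ≠ tri i (chain K ε n) := by
  rcases (distinct_near_far n).eq_or i with rfl | rfl | rfl
  · exact ((tri_zero_chain_lt_iff hε).2 hmn).ne'
  · rw [tri_near_chain]
    by_cases hp : Even m ↔ Even n
    · rw [← nearIdx_eq_of_even_iff hp, tri_near_chain]
      have := chainNear_lt hε hK hmn
      intro h; linarith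
    · rw [← farIdx_eq_nearIdx hp, tri_far_chain]
      have := half_le_chainFar hε hK (hmn.trans hn)
      have := chainNear_le hε hK (show n ≠ 0 by omega)
      intro h; linarith
  · rw [tri_far_chain]
    by_cases hp : Even m ↔ Even n
    · rw [← farIdx_eq_of_even_iff hp, tri_far_chain]
      rcases eq_or_ne m 0 with rfl | h0
      · have := chainFar_ge hε hK (show n ≠ 0 by omega) hn
        rw [chainFar_zero]
        intro h; linarith
      · have := chainFar_lt (K := K) hε h0 hmn
        intro h; linarith
    · rw [← nearIdx_eq_farIdx hp, tri_near_chain]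
      have := chainNear_le_half (n := m) hε hK
      have := chainFar_ge hε hK (show n ≠ 0 by omega) hn
      intro h; linarith

theorem tri_chain_ne_zero {n : ℕ} (hε : 0 < ε) (hK : K * ε ≤ 1 / 4) (hn : n < K) (i : Fin 3) :
    tri i (chain K ε n) ≠ 0 := by
  rcases (distinct_near_far n).eq_or i with rfl | rfl | rfl
  · exact (tri_zero_chain_pos hε hK hn).ne'
  · rw [tri_near_chain]
    exact neg_ne_zero.2 (chainNear_pos hε hn).ne'
  · rw [tri_far_chain]
    exact neg_ne_zero.2 (chainFar_pos hε hK hn).ne'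

theorem generalPosition_chainSet {M : ℕ} (hε : 0 < ε) (hK : K * ε ≤ 1 / 4) (hM : M < K) :
    GeneralPosition (chainSet K ε M) := by
  rw [generalPosition_iff]
  intro p hp q hq hne i
  rcases mem_chainSet.1 hp with rfl | ⟨m, hm, rfl⟩ <;>
    rcases mem_chainSet.1 hq with rfl | ⟨n, hn, rfl⟩
  · exact absurd rfl hne
  · rw [tri_zero]
    exact (tri_chain_ne_zero hε hK (by omega) i).symm
  · rw [tri_zero]
    exact tri_chain_ne_zero hε hK (by omega) i
  · rcases lt_trichotomy m n with hlt | rfl | hlt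
    · exact tri_chain_ne hε hK hlt (by omega) i
    · exact absurd rfl hne
    · exact (tri_chain_ne hε hK hlt (by omega) i).symm

/-- All chain points lie in the first positive cone of the origin, and `tri 0` decreases along the
chain, so the last one is closest. -/
theorem eq_chain_of_adj_zero {M : ℕ} (hε : 0 < ε) (hK : K * ε ≤ 1 / 4) (hM : M < K) {x : Plane}
    (h : (halfThetaSix (chainSet K ε M)).Adj x 0) : x = chain K ε M := by
  have hlt : ∀ n ≤ M, ∀ i, i ≠ 0 → tri i (chain K ε n) < tri i 0 := by
    intro n hn i hi
    rw [tri_zero]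
    rcases (distinct_near_far n).eq_or i with rfl | rfl | rfl
    · exact absurd rfl hi
    · rw [tri_near_chain]
      linarith [chainNear_pos hε (show n < K by omega)]
    · rw [tri_far_chain]
      linarith [chainFar_pos hε hK (show n < K by omega)]
  rcases mem_chainSet.1 (mem_of_adj h).1 with rfl | ⟨n, hn, rfl⟩
  · exact absurd rfl h.ne
  · have := tri_le_of_adj distinct_zero_one_two h.symm (hlt n hn 1 (by decide))
      (hlt n hn 2 (by decide)) (chain_mem_chainSet le_rfl) (hlt M le_rfl 1 (by decide))
      (hlt M le_rfl 2 (by decide))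
    rcases hn.lt_or_eq with hlt | rfl
    · exact absurd ((tri_zero_chain_lt_iff hε).2 hlt) (not_lt.2 this)
    · rfl

/-- A longer jump is blocked by a closer point in the same cone: point `1` or `2` with the parity of
`n` if `m = 0`, point `n - 2` if `m` and `n` have equal parity, point `m + 1` otherwise. -/
theorem le_add_two_of_adj_chain {M m n : ℕ} (hε : 0 < ε) (hK : K * ε ≤ 1 / 4) (hM : M < K)
    (hn : n ≤ M) (hmn : m < n)
    (h : (halfThetaSix (chainSet K ε M)).Adj (chain K ε m) (chain K ε n)) : n ≤ m + 2 := by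
  by_contra! hlt
  rcases eq_or_ne m 0 with rfl | hm
  · have key : ∀ l ≤ M, l ≠ 0 → (Even l ↔ Even n) → tri (farIdx n) (chain K ε l) <
        tri (farIdx n) (chain K ε 0) := by
      intro l hl hl0 hp
      have e : tri (farIdx n) (chain K ε 0) = -(1 / 2) := by
        by_cases hp : Even 0 ↔ Even n
        · rw [← farIdx_eq_of_even_iff hp, tri_far_chain, chainFar_zero]
        · rw [← nearIdx_eq_farIdx hp, tri_near_chain, chainNear_zero]
      rw [e, ← farIdx_eq_of_even_iff hp, tri_far_chain]
      linarith [chainFar_ge hε hK hl0 (show l < K by omega)]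
    obtain ⟨l, hl0, hl, hp⟩ : ∃ l, l ≠ 0 ∧ l < n ∧ (Even l ↔ Even n) := by
      by_cases hp : Even n
      · exact ⟨2, by omega, by omega, by simp [hp]⟩
      · exact ⟨1, by omega, by omega, by simp [hp]⟩
    have := tri_le_of_adj (distinct_near_far n).rotate h (key n hn (by omega) Iff.rfl)
      ((tri_zero_chain_lt_iff hε).2 hmn) (chain_mem_chainSet (show l ≤ M by omega))
      (key l (by omega) hl0 hp) ((tri_zero_chain_lt_iff hε).2 (by omega))
    rw [tri_near_chain, ← nearIdx_eq_of_even_iff hp, tri_near_chain] at this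
    linarith [chainNear_lt hε hK hl]
  by_cases hp : Even m ↔ Even n
  · have hp' : Even (n - 2) ↔ Even n := by
      rw [Nat.even_sub (by omega)]; simp
    have hne : n ≠ m + 3 := by
      rintro rfl
      rw [Nat.even_add] at hp
      have : ¬ Even 3 := by decide
      tauto
    have key : ∀ l < n, l ≠ 0 → (Even l ↔ Even n) →
        tri (nearIdx n) (chain K ε l) < tri (nearIdx n) (chain K ε n) ∧
        tri (farIdx n) (chain K ε l) < tri (farIdx n) (chain K ε n) := by
      intro l hl hl0 hp
      rw [tri_near_chain, tri_far_chain, ← farIdx_eq_of_even_iff hp, ← nearIdx_eq_of_even_iff hp,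
        tri_near_chain, tri_far_chain]
      have := chainNear_lt hε hK hl
      have := chainFar_lt (K := K) hε hl0 hl
      constructor <;> linarith
    have k1 := key m hmn hm hp
    have k2 := key (n - 2) (by omega) (by omega) hp'
    have := tri_le_of_adj (distinct_near_far n) h.symm k1.1 k1.2
      (chain_mem_chainSet (show n - 2 ≤ M by omega)) k2.1 k2.2
    exact absurd ((tri_zero_chain_lt_iff hε).2 (show m < n - 2 by omega)) (not_lt.2 this)
  · have hp' : Even (m + 1) ↔ Even n := by
      rw [Nat.even_add_one]; tauto
    have key : ∀ l ≤ M, m < l → (Even l ↔ Even n) →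
        tri (nearIdx m) (chain K ε l) < tri (nearIdx m) (chain K ε m) := by
      intro l hl hl0 hpl
      rw [tri_near_chain, nearIdx_eq_farIdx hp, ← farIdx_eq_of_even_iff hpl, tri_far_chain]
      have := chainNear_le hε hK hm
      have := chainFar_ge hε hK (show l ≠ 0 by omega) (show l < K by omega)
      linarith
    have := tri_le_of_adj (distinct_near_far m).rotate.rotate h ((tri_zero_chain_lt_iff hε).2 hmn)
      (key n hn hmn Iff.rfl) (chain_mem_chainSet (show m + 1 ≤ M by omega))
      ((tri_zero_chain_lt_iff hε).2 (show m < m + 1 by omega))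
      (key (m + 1) (by omega) (by omega) hp')
    rw [farIdx_eq_nearIdx hp, tri_near_chain, ← nearIdx_eq_of_even_iff hp', tri_near_chain] at this
    linarith [chainNear_lt hε hK (show m + 1 < n by omega)]

theorem adj_chain_of_le_add_two {M m n : ℕ} (hε : 0 < ε) (hK : K * ε ≤ 1 / 4) (hM : M < K)
    (hn : n ≤ M) (hmn : m < n) (hnm : n ≤ m + 2) :
    (halfThetaSix (chainSet K ε M)).Adj (chain K ε m) (chain K ε n) := by
  have hP := generalPosition_chainSet hε hK hM
  have memM := chain_mem_chainSet (K := K) (ε := ε) (show m ≤ M by omega)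
  have memN := chain_mem_chainSet (K := K) (ε := ε) hn
  rcases eq_or_ne m 0 with rfl | hm
  · have e : tri (farIdx n) (chain K ε 0) = -(1 / 2) := by
      by_cases hp : Even 0 ↔ Even n
      · rw [← farIdx_eq_of_even_iff hp, tri_far_chain, chainFar_zero]
      · rw [← nearIdx_eq_farIdx hp, tri_near_chain, chainNear_zero]
    refine adj_of_forall_tri_le hP (distinct_near_far n).rotate memM memN ?_
      ((tri_zero_chain_lt_iff hε).2 hmn) ?_
    · rw [e, tri_far_chain]
      linarith [chainFar_ge hε hK (show n ≠ 0 by omega) (show n < K by omega)]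
    · intro x hx hx1 hx2
      rw [e] at hx1
      rcases mem_chainSet.1 hx with rfl | ⟨p, hp, rfl⟩
      · rw [tri_zero] at hx1
        linarith
      · rw [tri_zero_chain_lt_iff hε] at hx2
        by_cases hpar : Even p ↔ Even n
        · rw [tri_near_chain, ← nearIdx_eq_of_even_iff hpar, tri_near_chain]
          have hle : n ≤ p := by
            by_contra! hlt
            obtain rfl : p = 1 := by omega
            obtain rfl : n = 2 := by omega
            simp at hpar
          rcases hle.lt_or_eq with hlt | rfl
          · linarith [chainNear_lt hε hK hlt]
          · exact le_rfl
        · rw [← nearIdx_eq_farIdx hpar, tri_near_chain] at hx1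
          linarith [chainNear_le hε hK (show p ≠ 0 by omega)]
  obtain rfl | rfl : n = m + 1 ∨ n = m + 2 := by omega
  · have hp : ¬ (Even m ↔ Even (m + 1)) := by rw [Nat.even_add_one]; tauto
    refine adj_of_forall_tri_le hP (distinct_near_far m).rotate.rotate memM memN
      ((tri_zero_chain_lt_iff hε).2 hmn) ?_ ?_
    · rw [tri_near_chain, nearIdx_eq_farIdx hp, tri_far_chain]
      have := chainNear_le hε hK hm
      have := chainFar_ge hε hK (show m + 1 ≠ 0 by omega) (show m + 1 < K by omega)
      linarith
    · intro x hx hx1 hx2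
      rw [tri_near_chain] at hx2
      rcases mem_chainSet.1 hx with rfl | ⟨p, hpM, rfl⟩
      · rw [tri_zero] at hx2
        linarith [chainNear_pos hε (show m < K by omega)]
      · rw [tri_zero_chain_lt_iff hε] at hx1
        by_cases hpar : Even p ↔ Even m
        · rw [← nearIdx_eq_of_even_iff hpar, tri_near_chain] at hx2
          linarith [chainNear_lt hε hK hx1]
        · rw [← nearIdx_eq_farIdx hpar, tri_near_chain, nearIdx_eq_farIdx hpar,
            farIdx_eq_nearIdx hp, tri_near_chain]
          rcases (show m + 1 ≤ p by omega).lt_or_eq with hlt | rfl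
          · linarith [chainNear_lt hε hK hlt]
          · exact le_rfl
  · have hp : Even m ↔ Even (m + 2) := by rw [Nat.even_add]; simp
    refine (adj_of_forall_tri_le hP (distinct_near_far (m + 2)) memN memM ?_ ?_ ?_).symm
    · rw [tri_near_chain, ← nearIdx_eq_of_even_iff hp, tri_near_chain]
      linarith [chainNear_lt hε hK hmn]
    · rw [tri_far_chain, ← farIdx_eq_of_even_iff hp, tri_far_chain]
      linarith [chainFar_lt (K := K) hε hm hmn]
    · intro x hx hx1 hx2
      rw [tri_near_chain] at hx1
      rw [tri_far_chain] at hx2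
      rcases mem_chainSet.1 hx with rfl | ⟨p, hpM, rfl⟩
      · rw [tri_zero] at hx1
        linarith [chainNear_pos hε (show m + 2 < K by omega)]
      · have hfar := chainFar_ge hε hK (show m + 2 ≠ 0 by omega) (show m + 2 < K by omega)
        by_cases hpar : Even p ↔ Even (m + 2)
        · rw [← nearIdx_eq_of_even_iff hpar, tri_near_chain] at hx1
          have hlt : p < m + 2 := by
            by_contra! hle
            rcases hle.lt_or_eq with hlt | rfl
            · linarith [chainNear_lt hε hK hlt]
            · exact lt_irrefl _ hx1
          have hne : p ≠ m + 1 := by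
            rintro rfl
            rw [← hp, Nat.even_add_one] at hpar
            tauto
          rw [← not_lt, tri_zero_chain_lt_iff hε]
          omega
        · rw [← nearIdx_eq_farIdx hpar, tri_near_chain] at hx2
          linarith [chainNear_le_half (n := p) hε hK]

/-- Each edge advances by at most two, and the origin is reachable only through point `M`, which is
too far. The key feature is that the right-hand side does not depend on `M`. -/
theorem kNeighborhood_chainSet {M k : ℕ} (hε : 0 < ε) (hK : K * ε ≤ 1 / 4) (hM : M < K)
    (hk : 2 * k < M) :
    kNeighborhood (chainSet K ε M) k (chain K ε 0) = {x | ∃ n ≤ 2 * k, x = chain K ε n} := by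
  have fwd : ∀ {u v : Plane} (p : (halfThetaSix (chainSet K ε M)).Walk u v) (m : ℕ),
      u = chain K ε m → m + 2 * p.length < M → ∃ n ≤ m + 2 * p.length, v = chain K ε n := by
    intro u v p
    induction p with
    | nil => intro m hm _; exact ⟨m, by omega, hm⟩
    | @cons u w v h q ih =>
      rintro m rfl hlen
      rw [SimpleGraph.Walk.length_cons] at hlen ⊢
      rcases mem_chainSet.1 (mem_of_adj h).2 with rfl | ⟨l, hl, rfl⟩
      · have := chain_injective hε (eq_chain_of_adj_zero hε hK hM h)
        omega
      · have hle : l ≤ m + 2 := by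
          rcases lt_or_ge m l with hlt | hge
          · exact le_add_two_of_adj_chain hε hK hM hl hlt h
          · omega
        obtain ⟨n, hn, hv⟩ := ih l rfl (by omega)
        exact ⟨n, by omega, hv⟩
  have bwd : ∀ k, 2 * k < M → ∀ n ≤ 2 * k,
      ∃ p : (halfThetaSix (chainSet K ε M)).Walk (chain K ε 0) (chain K ε n), p.length ≤ k := by
    intro k
    induction k with
    | zero =>
      intro _ n hn
      obtain rfl : n = 0 := by omega
      exact ⟨.nil, by simp⟩
    | succ k ih =>
      intro hk n hn
      rcases Nat.lt_or_ge (2 * k) n with hlt | hle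
      · rcases Nat.lt_or_ge n 2 with h2 | h2
        · have hadj := adj_chain_of_le_add_two hε hK hM (show n ≤ M by omega)
            (show 0 < n by omega) (by omega)
          exact ⟨hadj.toWalk, by simp⟩
        · obtain ⟨p, hp⟩ := ih (by omega) (n - 2) (by omega)
          have hadj := adj_chain_of_le_add_two hε hK hM (show n ≤ M by omega)
            (show n - 2 < n by omega) (by omega)
          exact ⟨p.concat hadj, by rw [SimpleGraph.Walk.length_concat]; omega⟩
      · obtain ⟨p, hp⟩ := ih (by omega) n hle
        exact ⟨p, by omega⟩
  ext x
  constructor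
  · rintro ⟨p, hp⟩
    obtain ⟨n, hn, hx⟩ := fwd p 0 rfl (by omega)
    exact ⟨n, by omega, hx⟩
  · rintro ⟨n, hn, rfl⟩
    exact bwd k hk n hn

theorem chain_zero_ne_zero (hε : 0 < ε) (hK : K * ε ≤ 1 / 4) (hK0 : 0 < K) : chain K ε 0 ≠ 0 := by
  intro h
  have := tri_zero_chain_pos hε hK hK0
  rw [h, tri_zero] at this
  exact lt_irrefl _ this

theorem inNegativeCone_chain_zero : InNegativeCone (chain K ε 0) 0 := by
  rw [inNegativeCone_iff]
  refine ⟨0, (mem_positiveCone_iff (distinct_near_far 0)).2 ?_⟩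
  rw [tri_near_chain, tri_far_chain, tri_zero, tri_zero, chainNear_zero, chainFar_zero]
  norm_num

theorem dist_chain_zero : dist (chain K ε 0) 0 = √3 / 2 := by
  have h := dist_sq_eq (distinct_near_far 0) (chain K ε 0) 0
  rw [tri_near_chain, tri_far_chain, tri_zero, tri_zero, chainNear_zero, chainFar_zero] at h
  have h3 : (√3 / 2) ^ 2 = 3 / 4 := by
    rw [div_pow, Real.sq_sqrt (by norm_num)]; norm_num
  refine (sq_eq_sq₀ dist_nonneg (by positivity)).1 ?_
  rw [h, h3]
  norm_num

/-- The length of a walk that enters the chain on the side opposite to its last vertex. -/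
theorem le_dist_add_walkLength {M n : ℕ} (hε : 0 < ε) (hK : K * ε ≤ 1 / 4) (hM : M < K)
    (hn : n ≠ 0) (hnM : n ≤ M) (hpar : ¬ (Even n ↔ Even M))
    (p : (halfThetaSix (chainSet K ε M)).Walk (chain K ε n) 0) :
    5 / 2 * (1 - K * ε) ≤ dist (chain K ε 0) (chain K ε n) + walkLength p := by
  have hM0 : M ≠ 0 := by omega
  have hMK : (M : ℝ) < K := by exact_mod_cast hM
  -- The gap is the same at all chain points except the source, so the three legs below have lengths
  -- at least `1/2`, `1` and `1` times it.
  have diff : ∀ n, n ≠ 0 → chainFar K ε n - chainNear K ε n = 1 - K * ε := by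
    intro n hn
    rw [chainFar, chainNear, if_neg hn, if_neg hn]
    ring
  have hne : chain K ε n ≠ 0 := by
    intro h
    have := tri_zero_chain_pos hε hK (show n < K by omega)
    rw [h, tri_zero] at this
    exact lt_irrefl _ this
  have h1 := dist_add_dist_le_walkLength (fun x => eq_chain_of_adj_zero hε hK hM) p hne
  have h2 : (1 - K * ε) / 2 ≤ dist (chain K ε 0) (chain K ε n) := by
    have := half_sub_le_dist (distinct_near_far n) (chain K ε 0) (chain K ε n)
    have e : tri (nearIdx n) (chain K ε 0) = -(1 / 2) ∧
        tri (farIdx n) (chain K ε 0) = -(1 / 2) := by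
      by_cases hp : Even 0 ↔ Even n
      · rw [← farIdx_eq_of_even_iff hp, ← nearIdx_eq_of_even_iff hp, tri_far_chain, tri_near_chain,
          chainFar_zero, chainNear_zero]
        simp
      · rw [← nearIdx_eq_farIdx hp, ← farIdx_eq_nearIdx hp, tri_far_chain, tri_near_chain,
          chainFar_zero, chainNear_zero]
        simp
    rw [e.1, e.2, tri_near_chain, tri_far_chain] at this
    linarith [diff n hn]
  have h3 : 1 - K * ε ≤ dist (chain K ε n) (chain K ε M) := by
    have := half_sub_le_dist (distinct_near_far M) (chain K ε n) (chain K ε M)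
    rw [tri_near_chain, tri_far_chain, ← nearIdx_eq_farIdx hpar, ← farIdx_eq_nearIdx hpar,
      tri_near_chain, tri_far_chain] at this
    linarith [diff n hn, diff M hM0]
  have h4 : 1 - K * ε ≤ dist (chain K ε M) 0 := by
    -- The permutation selects the far coordinate and `tri 0`, giving the bound `chainFar +
    -- chainNear / 2`.
    have := half_sub_le_dist (distinct_near_far M).swap.rotate.rotate.swap (chain K ε M) 0
    have hs := tri_sum (distinct_near_far M) (chain K ε M)
    simp only [tri_zero] at this
    rw [tri_far_chain, tri_near_chain] at hs
    rw [tri_far_chain] at this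
    linarith [diff M hM0, chainNear_pos hε hM]
  linarith

end Chain

/-! ### The adversary argument for negative cones. -/

theorem le_of_competitive_negative {k : ℕ} {A : RoutingAlgorithm} {d : ℝ}
    (h : IsCompetitive k A InNegativeCone d) : 5 / √3 ≤ d := by
  have key : ∀ δ : ℝ, 0 < δ → δ ≤ 1 / 4 → 5 / 2 * (1 - δ) ≤ d * (√3 / 2) := by
    intro δ hδ hδ'
    -- This leaves room for chains ending at `2 * k + 2` and `2 * k + 3`: opposite parities, both
    -- beyond the view of the source.
    set K : ℕ := 2 * k + 4 with hKdef
    have hK0 : (0 : ℝ) < K := by rw [hKdef]; positivity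
    set ε : ℝ := δ / K with hεdef
    have hε : 0 < ε := by positivity
    have hKδ : K * ε = δ := by rw [hεdef]; field_simp
    have hK : K * ε ≤ 1 / 4 := by rw [hKδ]; exact hδ'
    set N : Set Plane := {x | ∃ n ≤ 2 * k, x = chain K ε n}
    have hne : chain K ε 0 ≠ 0 := chain_zero_ne_zero hε hK (by omega)
    have run : ∀ M, 2 * k < M → M < K →
        (halfThetaSix (chainSet K ε M)).Adj (chain K ε 0) (A (chain K ε 0) 0 N) ∧
        DeliversWithin k A (chainSet K ε M) (A (chain K ε 0) 0 N) 0
          (d * (√3 / 2) - dist (chain K ε 0) (A (chain K ε 0) 0 N)) := by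
      intro M hM hMK
      have := (h (chainSet K ε M) (generalPosition_chainSet hε hK hMK) (chain K ε 0)
        (chain_mem_chainSet (by omega)) 0 (mem_chainSet.2 (Or.inl rfl)) hne
        inNegativeCone_chain_zero).uncons hne
      rwa [kNeighborhood_chainSet hε hK hMK hM, dist_chain_zero] at this
    obtain ⟨hadj, -⟩ := run (2 * k + 2) (by omega) (by omega)
    obtain ⟨n, hn0, hn2, hw⟩ : ∃ n, n ≠ 0 ∧ n ≤ 2 ∧ A (chain K ε 0) 0 N = chain K ε n := by
      rcases mem_chainSet.1 (mem_of_adj hadj).2 with h0 | ⟨n, hn, hw⟩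
      · rw [h0] at hadj
        have := chain_injective hε (eq_chain_of_adj_zero hε hK (by omega) hadj)
        omega
      · have hn0 : n ≠ 0 := by
          rintro rfl
          rw [hw] at hadj
          exact hadj.ne rfl
        rw [hw] at hadj
        have hn2 := le_add_two_of_adj_chain hε hK (by omega) hn (Nat.pos_of_ne_zero hn0) hadj
        exact ⟨n, hn0, by omega, hw⟩
    -- The first step leads to the same point `n` for every `M`, so `M` may be chosen afterwards
    -- with the parity opposite to `n`.
    have finish : ∀ M, 2 * k < M → M < K → n ≤ M → ¬ (Even n ↔ Even M) →
        5 / 2 * (1 - δ) ≤ d * (√3 / 2) := by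
      intro M hM hMK hnM hpar
      obtain ⟨-, hdel⟩ := run M hM hMK
      rw [hw] at hdel
      obtain ⟨p, hp⟩ := hdel.exists_walk
      have := le_dist_add_walkLength hε hK hMK hn0 hnM hpar p
      rw [hKδ] at this
      linarith
    have hpar2 : Even (2 * k + 2) := by simp [Nat.even_add]
    by_cases hne : Even n
    · exact finish (2 * k + 3) (by omega) (by omega) (by omega) (by
        rw [show 2 * k + 3 = 2 * k + 2 + 1 from rfl, Nat.even_add_one]; tauto)
    · exact finish (2 * k + 2) (by omega) (by omega) (by omega) (by tauto)
  have h3 : (0 : ℝ) < √3 := by positivity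
  rw [div_le_iff₀ h3]
  by_contra! hlt
  -- The bound `key` forces `δ ≥ (5 - d√3) / 5`; half of this value is a contradiction.
  rcases le_total (1 / 4) ((5 - d * √3) / 10) with hle | hle
  · have := key (1 / 4) (by norm_num) le_rfl
    linarith
  · have := key ((5 - d * √3) / 10) (by linarith) hle
    linarith

end HalfTheta

end

theorem mainTheorem4 :
    -- one `1`-local algorithm attains both ratios (and `5 / √3` over all pairs)
    (∃ A : HalfTheta.RoutingAlgorithm,
      HalfTheta.HasRoutingRatio 1 A HalfTheta.InPositiveCone 2 ∧
      HalfTheta.HasRoutingRatio 1 A HalfTheta.InNegativeCone (5 / √3) ∧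
      HalfTheta.HasRoutingRatio 1 A (fun _ _ => True) (5 / √3)) ∧
    -- both ratios are best possible for `k`-local algorithms
    (∀ (k : ℕ) (A : HalfTheta.RoutingAlgorithm) (d : ℝ),
      (HalfTheta.IsCompetitive k A HalfTheta.InPositiveCone d → 2 ≤ d) ∧
      (HalfTheta.IsCompetitive k A HalfTheta.InNegativeCone d → 5 / √3 ≤ d)) ∧
    -- separation from the spanning ratio
    (HalfTheta.IsSpanningRatio 2 ∧ (2 : ℝ) < 5 / √3 ∧
      ∀ (k : ℕ) (A : HalfTheta.RoutingAlgorithm) (d : ℝ),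
        HalfTheta.IsCompetitive k A (fun _ _ => True) d → 2 < d) := by
  have restrict : ∀ {k : ℕ} {A : HalfTheta.RoutingAlgorithm} {d : ℝ},
      HalfTheta.IsCompetitive k A (fun _ _ => True) d → 5 / √3 ≤ d := fun h =>
    HalfTheta.le_of_competitive_negative fun P hP s hs t ht hne _ => h P hP s hs t ht hne trivial
  refine ⟨⟨HalfTheta.router, ⟨HalfTheta.router_competitive_positive,
      fun d h => HalfTheta.two_le_of_competitive_positive h⟩,
      ⟨HalfTheta.router_competitive_negative,
        fun d h => HalfTheta.le_of_competitive_negative h⟩,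
      ⟨HalfTheta.router_competitive, fun d h => restrict h⟩⟩,
    fun k A d => ⟨HalfTheta.two_le_of_competitive_positive,
      HalfTheta.le_of_competitive_negative⟩,
    HalfTheta.isSpanningRatio_two, HalfTheta.two_lt_five_div_sqrt_three,
    fun k A d h => HalfTheta.two_lt_five_div_sqrt_three.trans_le (restrict h)⟩
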